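/- In $(2,3)$-Maharaja Nim a position is a pair $(x,y)$ of non-negative integers; two players alternately move from $(x,y)$ to $(x-k,y)$, $(x,y-k)$ or $(x-k,y-k)$ with $k\ge 1$ (the moves of Wythoff Nim), or to $(x-2,y-3)$ or $(x-3,y-2)$, where no coordinate may become negative; a player who cannot move loses. A position is P if the second player to move has a winning strategy, that is, if none of its options is P. The bit-string of the game is the infinite string $s=s_1s_2s_3\ldots$ with $s_x=0$ if there is a P-position $(x,y)$ with $y>x$, and $s_x=1$ otherwise. Consider the (non-prefix-free) dictionary $$0\to 10,\qquad 1\to 0,\qquad 01000\to 100011100,\qquad 01010\to 10001100 .$$ Its translation process starts with the string $0100011100000$ and a read head in front of the 9th bit. In each step the read head accepts the longest left hand side word of the dictionary that occurs at its position, moves to the end of this word, and the translate of the word is appended to the end of the string. Then the following hold. 1. The process never terminates, and its infinite output is the bit-string $s$ of $(2,3)$-Maharaja Nim. 2. The dictionary converges: there are a constant $q$ and a rule that, for every position $i>q$ in $s$, determines from the bits $s_{i-q},\ldots,s_{i+q}$ alone the left hand side word that the process reads over position $i$, and where this word starts. 3. The problem of deciding, given $x$ and $y$ in binary, whether $(x,y)$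 is a P-position has polynomial time complexity: it is solved by a Turing machine in a number of steps bounded by a polynomial in the total number of binary digits of $x$ and $y$ (that is, for $x,y\ge 1$, in $\log_2(xy)+O(1)$). -/

import Mathlib

namespace MaharajaNim

/-! ### The game -/

/-- The moves of (2,3)-Maharaja Nim on `ℕ × ℕ`: the moves of Wythoff Nim (a rook or bishop move
towards the origin) together with the two jumps `(2,3)` and `(3,2)`. -/
inductive Move : ℕ × ℕ → ℕ × ℕ → Prop
  | horizontal (x y k : ℕ) (hk : 0 < k) : Move (x + k, y) (x, y)
  | vertical (x y k : ℕ) (hk : 0 < k) : Move (x, y + k) (x, y)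
  | diagonal (x y k : ℕ) (hk : 0 < k) : Move (x + k, y + k) (x, y)
  | jump23 (x y : ℕ) : Move (x + 2, y + 3) (x, y)
  | jump32 (x y : ℕ) : Move (x + 3, y + 2) (x, y)

theorem Move.sum_lt {p q : ℕ × ℕ} (h : Move p q) : q.1 + q.2 < p.1 + p.2 := by
  cases h <;> simp only <;> omega

/-- `p` is a P-position: the player who has just moved to `p` wins (a player who cannot move
loses), that is, no option of `p` is a P-position. -/
def IsP (p : ℕ × ℕ) : Prop :=
  ∀ q : ℕ × ℕ, Move p q → ¬ IsP q
termination_by p.1 + p.2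
decreasing_by exact Move.sum_lt ‹_›

open Classical in
/-- The bit of column `x`: it is `0` if and only if column `x` contains a P-position strictly
above the main diagonal. -/
noncomputable def columnBit (x : ℕ) : Fin 2 :=
  if ∃ y : ℕ, x < y ∧ IsP (x, y) then 0 else 1

/-- The bit-string of the game lists the bits of the columns `1, 2, 3, …`;
the entry with index `i` (counted from zero) belongs to column `i + 1`. -/
noncomputable def bitString (i : ℕ) : Fin 2 :=
  columnBit (i + 1)

/-! ### Dictionary processes -/

/-- A finite binary dictionary: a list of translations (left hand side word, translate).
A word may be a prefix of another word. -/
abbrev Dictionary : Type := List (List (Fin 2) × List (Fin 2))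

/-- A stage of a dictionary process: the bit-string printed so far, and the index (from zero) of
the next bit under the read head. -/
structure Stage where
  string : List (Fin 2)
  head : ℕ

namespace Dictionary

/-- The entry accepted by a read head in front of `u`: the one with the longest left hand side
word among the entries whose word is a prefix of `u`; there is none if no word is such a prefix. -/
def accepted (D : Dictionary) (u : List (Fin 2)) : Option (List (Fin 2) × List (Fin 2)) :=
  (D.filter fun e => e.1.isPrefixOf u).argmax fun e => e.1.length

/-- One step: read the accepted word, and append its translate to the end of the string. -/
def step (D : Dictionary) (c : Stage) : Option Stage :=
  (D.accepted (c.string.drop c.head)).map fun e => ⟨c.string ++ e.2, c.head + e.1.length⟩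

/-- The stage after `t` steps; `none` if the process has stopped before. -/
def run (D : Dictionary) (c : Stage) : ℕ → Option Stage
  | 0 => some c
  | t + 1 => (D.run c t).bind D.step

/-- The process of `D` started at `c` never stops, and its output is the infinite string `s`. -/
def Generates (D : Dictionary) (c : Stage) (s : ℕ → Fin 2) : Prop :=
  (∀ t : ℕ, ∃ c' : Stage, D.run c t = some c' ∧
    ∀ (i : ℕ) (hi : i < c'.string.length), c'.string[i] = s i) ∧
  ∀ n : ℕ, ∃ (t : ℕ) (c' : Stage), D.run c t = some c' ∧ n < c'.string.length

/-- In the process of `D` started at `c`, the left hand side word `w` is read (and translated)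
starting at index `p`. -/
def ReadsAt (D : Dictionary) (c : Stage) (p : ℕ) (w : List (Fin 2)) : Prop :=
  ∃ (t : ℕ) (c' : Stage), D.run c t = some c' ∧ c'.head = p ∧
    ∃ v : List (Fin 2), D.accepted (c'.string.drop p) = some (w, v)

/-- The dictionary converges on the string `s`: there are a bound `q` and a rule `locate` such
that for every index `i ≥ q`, the rule finds from the bits at distance at most `q` from `i` alone
the left hand side word `w` that covers `i`, and the number `k` of bits of `w` that precede `i`
(so that `w` starts at index `i - k`). -/
def Converges (D : Dictionary) (c : Stage) (s : ℕ → Fin 2) : Prop :=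
  ∃ (q : ℕ) (locate : (Fin (2 * q + 1) → Fin 2) → ℕ × List (Fin 2)), ∀ i : ℕ, q ≤ i →
    ∃ (k : ℕ) (w : List (Fin 2)), locate (fun j => s (i - q + j)) = (k, w) ∧
      k < w.length ∧ k ≤ i ∧ D.ReadsAt c (i - k) w

end Dictionary

/-- The dictionary of (2,3)-Maharaja Nim. -/
def dictionary : Dictionary :=
  [([0], [1, 0]),
   ([1], [0]),
   ([0, 1, 0, 0, 0], [1, 0, 0, 0, 1, 1, 1, 0, 0]),
   ([0, 1, 0, 1, 0], [1, 0, 0, 0, 1, 1, 0, 0])]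

/-- The initial stage `01000111_00000`: the first eight columns have been read, and the read head
`_` is in front of the bit of column nine. -/
def initialStage : Stage :=
  ⟨[0, 1, 0, 0, 0, 1, 1, 1, 0, 0, 0, 0, 0], 8⟩

/-! ### The decision problem -/

open Classical in
/-- Deciding whether `(x, y)` satisfies `A` takes polynomial time: some Turing machine computes
the answer from the binary expansions of `x` and `y` in a number of steps bounded by a polynomial
in the length of the input, the total number of binary digits of `x` and `y`
(which is at most `2 + log₂ (x * y)` for positive `x` and `y`). -/
def PolyTimeDecidable (A : ℕ × ℕ → Prop) : Prop :=
  Nonempty (Turing.TM2ComputableInPolyTime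
    (Computability.encodingProd Computability.encodingNatBool
      Computability.encodingNatBool).encode
    Computability.encodeBool
    (fun p : ℕ × ℕ => decide (A p)))

end MaharajaNim

/-! ### The dictionary process as one infinite run of reading and writing. -/

namespace MaharajaNim

/-! String and game are both organised by the words that the head reads. A translate has as many
zeros as its word has bits, and as many ones as its word has zeros. So the zeros of the string can
serve as the columns of the P-positions above the diagonal and the ones as their rows, matched word
by word according to the fixed patterns `Entry.cells`. The resulting set `Upper` uses every positive
integer once as a coordinate and every positive difference once, as in Wythoff Nim. Reading `010` by
short words would put two positions a jump (2,3) apart; the long words rearrange exactly these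
places. With the mirror images and the origin, `Upper` forms `Kernel`. No move joins two of its
members (`Kernel.not_move`), and every other position has a move into it
(`exists_move_of_not_kernel`), so it is the set of P-positions (`isP_iff_kernel`) and the output is
the bit-string of the game.

Two facts about the string exclude jumps between different words: a word that starts at `010` is
long (`entry_long`), and `01000` is followed by the word `1` (`entry_succ_of_longA`). Both hold
because a violation can be traced back, through the translates that wrote it, to earlier words that
cannot have been read.

Convergence: the second one of `11` always starts a word (`wordStart_of_one_one`), and `11` recurs
within 1000 bits (`exists_one_one`). Two places with equal surroundings thus have a common word
start, after which they are read alike.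

Polynomial time: the process acts roughly like one fixed Fibonacci substitution. If `x` is written
with Fibonacci digits and `m` is the number with the digits shifted down, then the number of zeros
among the first `x` bits differs from `m` by at most 450 (`abs_zeros_sub_digitPair`). This deviation
and a window of fixed radius around `x` determine the same data after a further digit
(`window_step`). So a finite automaton reading the digits of `x` computes `y - (x + m)` for the
P-position `(x, y)` with `x ≤ y`, if there is one (`exists_digit_automaton`). A machine sweeping a
binary tape finds greedy Fibonacci digits, runs the automaton and compares, in linearly many sweeps
of linear length. -/

/-- The entries of the dictionary. -/
inductive Entry
  | zero
  | one
  | longA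
  | longB
  deriving DecidableEq

namespace Entry

/-- The left hand side word of an entry. -/
def lhs : Entry → List (Fin 2)
  | zero => [0]
  | one => [1]
  | longA => [0, 1, 0, 0, 0]
  | longB => [0, 1, 0, 1, 0]

/-- The translate of an entry. -/
def translate : Entry → List (Fin 2)
  | zero => [1, 0]
  | one => [0]
  | longA => [1, 0, 0, 0, 1, 1, 1, 0, 0]
  | longB => [1, 0, 0, 0, 1, 1, 0, 0]

/-- The entry accepted in front of `u`. -/
def read (u : List (Fin 2)) : Entry :=
  if longA.lhs <+: u then longA
  else if longB.lhs <+: u then longB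
  else if zero.lhs <+: u then zero
  else one

theorem eq_cons_of_five_le_length {u : List (Fin 2)} (h : 5 ≤ u.length) :
    ∃ x0 x1 x2 x3 x4 v, u = x0 :: x1 :: x2 :: x3 :: x4 :: v := by
  match u, h with
  | x0 :: x1 :: x2 :: x3 :: x4 :: v, _ => exact ⟨x0, x1, x2, x3, x4, v, rfl⟩

theorem read_lhs_prefix {u : List (Fin 2)} (h : 5 ≤ u.length) : (read u).lhs <+: u := by
  unfold read
  split_ifs with h1 h2 h3
  · exact h1
  · exact h2
  · exact h3
  · obtain ⟨x0, x1, x2, x3, x4, v, rfl⟩ := eq_cons_of_five_le_length h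
    have : x0 = 1 := by
      have : x0 ≠ 0 := fun h0 => h3 (by simp [lhs, h0])
      omega
    simp [lhs, this]

/-- No word is longer than five bits, so five visible bits decide what is accepted, and there are
only 32 cases. -/
theorem accepted_eq_read {u : List (Fin 2)} (h : 5 ≤ u.length) :
    dictionary.accepted u = some ((read u).lhs, (read u).translate) := by
  obtain ⟨x0, x1, x2, x3, x4, v, rfl⟩ := eq_cons_of_five_le_length h
  fin_cases x0 <;> fin_cases x1 <;> fin_cases x2 <;> fin_cases x3 <;> fin_cases x4 <;>
    simp [read, lhs, translate, dictionary, Dictionary.accepted, List.argmax, List.argAux]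

end Entry

/-- The stages of the process. -/
def stage : ℕ → Stage
  | 0 => initialStage
  | t + 1 =>
    ⟨(stage t).string ++ (Entry.read ((stage t).string.drop (stage t).head)).translate,
      (stage t).head + (Entry.read ((stage t).string.drop (stage t).head)).lhs.length⟩

/-- The `n`-th entry whose left hand side word is read; the first four of them cover the part of
the initial string in front of the read head. -/
def entry : ℕ → Entry
  | 0 => .longA
  | 1 => .one
  | 2 => .one
  | 3 => .one
  | n + 4 => Entry.read ((stage n).string.drop (stage n).head)

/-- The index at which the `n`-th word starts. -/
def wordStart : ℕ → ℕ
  | 0 => 0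
  | n + 1 => wordStart n + (entry n).lhs.length

/-- The index at which the translate of the `n`-th word starts. -/
def translateStart : ℕ → ℕ
  | 0 => 1
  | n + 1 => translateStart n + (entry n).translate.length

theorem stage_head (t : ℕ) : (stage t).head = wordStart (t + 4) := by
  induction t with
  | zero => rfl
  | succ t ih => exact congrArg (· + _) ih

theorem stage_string_length (t : ℕ) : (stage t).string.length = translateStart (t + 4) := by
  induction t with
  | zero => rfl
  | succ t ih => simp only [stage, List.length_append, ih]; rfl

theorem Entry.lhs_length_le_translate (e : Entry) : e.lhs.length ≤ e.translate.length := by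
  cases e <;> simp [lhs, translate]

theorem Entry.lhs_length_pos (e : Entry) : 0 < e.lhs.length := by
  cases e <;> simp [lhs]

theorem Entry.lhs_length_le (e : Entry) : e.lhs.length ≤ 5 := by
  cases e <;> simp [lhs]

theorem Entry.translate_length_pos (e : Entry) : 0 < e.translate.length := by
  cases e <;> simp [translate]

theorem Entry.translate_length_le (e : Entry) : e.translate.length ≤ 9 := by
  cases e <;> simp [translate]

/-- A translate is never shorter than its word, so the head never gets closer to the end of the
string than the initial five bits. Hence the process cannot stop, and the end of the string never
hides part of a matching word. -/
theorem wordStart_add_five_le (t : ℕ) : wordStart (t + 4) + 5 ≤ translateStart (t + 4) := by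
  induction t with
  | zero => decide
  | succ t ih =>
    have := (entry (t + 4)).lhs_length_le_translate
    rw [show t + 1 + 4 = (t + 4) + 1 by ring, wordStart, translateStart]
    omega

theorem five_le_length_drop (t : ℕ) : 5 ≤ ((stage t).string.drop (stage t).head).length := by
  rw [List.length_drop, stage_head, stage_string_length]
  have := wordStart_add_five_le t
  omega

theorem step_stage (t : ℕ) : dictionary.step (stage t) = some (stage (t + 1)) := by
  rw [Dictionary.step, Entry.accepted_eq_read (five_le_length_drop t)]
  rfl

theorem run_eq_stage (t : ℕ) : dictionary.run initialStage t = some (stage t) := by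
  induction t with
  | zero => rfl
  | succ t ih => rw [Dictionary.run, ih, Option.bind_some, step_stage]

theorem stage_string_prefix {t t' : ℕ} (h : t ≤ t') : (stage t).string <+: (stage t').string := by
  induction h with
  | refl => exact List.prefix_refl _
  | step _ ih => exact ih.trans (List.prefix_append _ _)

theorem lt_translateStart (n : ℕ) : n < translateStart n := by
  induction n with
  | zero => decide
  | succ n ih =>
    have := (entry n).translate_length_pos
    rw [translateStart]
    omega

theorem le_wordStart (n : ℕ) : n ≤ wordStart n := by
  induction n with
  | zero => decide
  | succ n ih =>
    have := (entry n).lhs_length_pos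
    rw [wordStart]
    omega

/-- The output of the process. -/
def output (i : ℕ) : Fin 2 := (stage i).string.getD i 0

theorem stage_string_getElem (t i : ℕ) (h : i < (stage t).string.length) :
    (stage t).string[i] = output i := by
  have hi : i < (stage i).string.length := by
    rw [stage_string_length]
    have := lt_translateStart (i + 4)
    omega
  rw [output, List.getD_eq_getElem _ _ hi]
  rcases le_total t i with hti | hti
  · exact (stage_string_prefix hti).getElem h
  · exact ((stage_string_prefix hti).getElem hi).symm

theorem generates_output : dictionary.Generates initialStage output := by
  refine ⟨fun t => ⟨stage t, run_eq_stage t, fun i hi => stage_string_getElem t i hi⟩,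
    fun n => ⟨n, stage n, run_eq_stage n, ?_⟩⟩
  rw [stage_string_length]
  have := lt_translateStart (n + 4)
  omega

/-- The initial string is a single `0` followed by the translates of `01000`, `1`, `1`, `1`, the
words in front of the head. So the rule for translates holds from the first word on, with the offset
1 in `translateStart`. -/
theorem output_translate (n j : ℕ) (h : j < (entry n).translate.length) :
    output (translateStart n + j) = (entry n).translate[j] := by
  match n, h with
  | 0, h =>
    rw [← stage_string_getElem 0 (translateStart 0 + j)
      (by simp [translateStart, stage, initialStage, entry, Entry.translate] at h ⊢; omega)]
    simp [entry, Entry.translate] at h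
    interval_cases j <;> rfl
  | 1, h =>
    simp [entry, Entry.translate] at h
    subst h
    rfl
  | 2, h =>
    simp [entry, Entry.translate] at h
    subst h
    rfl
  | 3, h =>
    simp [entry, Entry.translate] at h
    subst h
    rfl
  | n + 4, h =>
    have hl := stage_string_length n
    have hlt : translateStart (n + 4) + j < (stage (n + 1)).string.length := by
      rw [stage_string_length]
      exact Nat.add_lt_add_left h (translateStart (n + 4))
    rw [← stage_string_getElem (n + 1) _ hlt]
    simp only [stage]
    rw [List.getElem_append_right (by omega)]
    simp only [hl, Nat.add_sub_cancel_left]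
    rfl

theorem drop_getElem (t j : ℕ) (h : j < ((stage t).string.drop (stage t).head).length) :
    ((stage t).string.drop (stage t).head)[j] = output (wordStart (t + 4) + j) := by
  rw [List.getElem_drop, stage_string_getElem, stage_head]

theorem output_word (n j : ℕ) (h : j < (entry n).lhs.length) :
    output (wordStart n + j) = (entry n).lhs[j] := by
  match n, h with
  | 0, h =>
    simp [entry, Entry.lhs] at h
    interval_cases j <;> rfl
  | 1, h =>
    simp [entry, Entry.lhs] at h
    subst h
    rfl
  | 2, h =>
    simp [entry, Entry.lhs] at h
    subst h
    rfl
  | 3, h =>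
    simp [entry, Entry.lhs] at h
    subst h
    rfl
  | n + 4, h =>
    have hp := Entry.read_lhs_prefix (five_le_length_drop n)
    rw [← drop_getElem n j (h.trans_le hp.length_le)]
    exact (hp.getElem h).symm

/-- The read head accepts the longest word: a short word is never read in front of a long one. -/
theorem not_long_prefix (n : ℕ) (h : entry n = .zero) (h0 : output (wordStart n) = 0)
    (h1 : output (wordStart n + 1) = 1) (h2 : output (wordStart n + 2) = 0)
    (h4 : output (wordStart n + 4) = 0) : False := by
  match n, h with
  -- The four words in front of the initial head are not the word `0`, so only words read by the
  -- process remain.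
  | n + 4, h =>
    obtain ⟨x0, x1, x2, x3, x4, v, hu⟩ :=
      Entry.eq_cons_of_five_le_length (five_le_length_drop n)
    have key (j : ℕ) (hj : j < 5) := drop_getElem n j (hj.trans_le (five_le_length_drop n))
    have k0 := key 0 (by norm_num)
    have k1 := key 1 (by norm_num)
    have k2 := key 2 (by norm_num)
    have k4 := key 4 (by norm_num)
    simp only [hu, List.getElem_cons_zero, List.getElem_cons_succ] at k0 k1 k2 k4
    rw [entry, hu, k0, k1, k2, k4, add_zero, h0, h1, h2, h4] at h
    fin_cases x3 <;> simp [Entry.read, Entry.lhs] at h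

/-- All that the `n`-th reading step does to the output. -/
theorem entry_spec (n : ℕ) :
    (entry n = .zero ∧ wordStart (n + 1) = wordStart n + 1 ∧
      translateStart (n + 1) = translateStart n + 2 ∧ output (wordStart n) = 0 ∧
      output (translateStart n) = 1 ∧ output (translateStart n + 1) = 0) ∨
    (entry n = .one ∧ wordStart (n + 1) = wordStart n + 1 ∧
      translateStart (n + 1) = translateStart n + 1 ∧ output (wordStart n) = 1 ∧
      output (translateStart n) = 0) ∨
    (entry n = .longA ∧ wordStart (n + 1) = wordStart n + 5 ∧
      translateStart (n + 1) = translateStart n + 9 ∧ output (wordStart n) = 0 ∧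
      output (wordStart n + 1) = 1 ∧ output (wordStart n + 2) = 0 ∧
      output (wordStart n + 3) = 0 ∧ output (wordStart n + 4) = 0 ∧
      output (translateStart n) = 1 ∧ output (translateStart n + 1) = 0 ∧
      output (translateStart n + 2) = 0 ∧ output (translateStart n + 3) = 0 ∧
      output (translateStart n + 4) = 1 ∧ output (translateStart n + 5) = 1 ∧
      output (translateStart n + 6) = 1 ∧ output (translateStart n + 7) = 0 ∧
      output (translateStart n + 8) = 0) ∨
    (entry n = .longB ∧ wordStart (n + 1) = wordStart n + 5 ∧
      translateStart (n + 1) = translateStart n + 8 ∧ output (wordStart n) = 0 ∧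
      output (wordStart n + 1) = 1 ∧ output (wordStart n + 2) = 0 ∧
      output (wordStart n + 3) = 1 ∧ output (wordStart n + 4) = 0 ∧
      output (translateStart n) = 1 ∧ output (translateStart n + 1) = 0 ∧
      output (translateStart n + 2) = 0 ∧ output (translateStart n + 3) = 0 ∧
      output (translateStart n + 4) = 1 ∧ output (translateStart n + 5) = 1 ∧
      output (translateStart n + 6) = 0 ∧ output (translateStart n + 7) = 0) := by
  have hw := output_word n
  have ht := output_translate n
  rw [wordStart, translateStart]
  generalize entry n = e at *
  have hw0 := hw 0
  have hw1 := hw 1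
  have hw2 := hw 2
  have hw3 := hw 3
  have hw4 := hw 4
  have ht0 := ht 0
  have ht1 := ht 1
  have ht2 := ht 2
  have ht3 := ht 3
  have ht4 := ht 4
  have ht5 := ht 5
  have ht6 := ht 6
  have ht7 := ht 7
  have ht8 := ht 8
  cases e <;> simp_all [Entry.lhs, Entry.translate]

theorem exists_wordStart_le (i : ℕ) : ∃ n, wordStart n ≤ i ∧ i < wordStart (n + 1) := by
  have h : ∃ n, i < wordStart (n + 1) := ⟨i, le_wordStart (i + 1)⟩
  classical
  refine ⟨Nat.find h, ?_, Nat.find_spec h⟩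
  rcases hn : Nat.find h with _ | m
  · exact Nat.zero_le i
  · exact not_lt.1 (Nat.find_min h (hn ▸ Nat.lt_succ_self m))

theorem exists_translateStart_le {i : ℕ} (hi : 0 < i) :
    ∃ n, translateStart n ≤ i ∧ i < translateStart (n + 1) := by
  have h : ∃ n, i < translateStart (n + 1) := ⟨i, (lt_translateStart (i + 1)).trans' (by omega)⟩
  classical
  refine ⟨Nat.find h, ?_, Nat.find_spec h⟩
  rcases hn : Nat.find h with _ | m
  · exact hi
  · exact not_lt.1 (Nat.find_min h (hn ▸ Nat.lt_succ_self m))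

theorem strictMono_wordStart : StrictMono wordStart :=
  strictMono_nat_of_lt_succ fun n => by
    have := (entry n).lhs_length_pos
    rw [wordStart]
    omega

theorem strictMono_translateStart : StrictMono translateStart :=
  strictMono_nat_of_lt_succ fun n => by
    have := (entry n).translate_length_pos
    rw [translateStart]
    omega

theorem output_eq_one_iff (i : ℕ) : output i = 1 ↔ output i ≠ 0 := by
  omega

/-! ### Counting zeros, and the local structure of the output. -/

/-- The number of zeros among the first `i` bits of the output. -/
def zeros (i : ℕ) : ℕ := Nat.count (fun j => output j = 0) i

theorem zeros_zero : zeros 0 = 0 := rfl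

theorem zeros_succ (i : ℕ) : zeros (i + 1) = zeros i + if output i = 0 then 1 else 0 :=
  Nat.count_succ _ _

theorem zeros_mono : Monotone zeros := Nat.count_monotone _

theorem zeros_add_le (i k : ℕ) : zeros (i + k) ≤ zeros i + k := by
  induction k with
  | zero => simp
  | succ k ih =>
    rw [← add_assoc, zeros_succ]
    split_ifs <;> omega

theorem output_zero : output 0 = 0 := rfl

/-- Every translate has as many zeros as its word has bits; the summand 1 is the `0` in front of the
first translate. -/
theorem zeros_translateStart (n : ℕ) : zeros (translateStart n) = 1 + wordStart n := by
  induction n with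
  | zero => decide
  | succ n ih =>
    rcases entry_spec n with h | h | h | h <;> simp [h, zeros_succ] <;> omega

/-- Every translate exceeds its word in length by the number of zeros of the word. -/
theorem translateStart_eq (n : ℕ) :
    translateStart n = 1 + wordStart n + zeros (wordStart n) := by
  induction n with
  | zero => rfl
  | succ n ih =>
    rcases entry_spec n with h | h | h | h <;> simp [h, zeros_succ] <;> omega

/-- The last bit of a translate, and the bit in front of the first translate, is `0`. -/
theorem output_translateStart_sub_one (n : ℕ) : output (translateStart n - 1) = 0 := by
  cases n with
  | zero => rfl
  | succ n => rcases entry_spec n with h | h | h | h <;> grind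

/-- A one that follows a zero inside a translate opens the block `111` or `11` of a long translate.
An isolated one is therefore the first bit of its translate. -/
theorem translateStart_of_rise_fall {i : ℕ} (h0 : output i = 0) (h1 : output (i + 1) = 1)
    (h2 : output (i + 2) = 0) : ∃ m, translateStart m = i + 1 ∧ entry m ≠ .one := by
  obtain ⟨m, hm, hm'⟩ := exists_translateStart_le (Nat.succ_pos i)
  obtain ⟨k, hk⟩ := Nat.exists_eq_add_of_le hm
  rcases entry_spec m with h | h | h | h
  · have : k < 2 := by omega
    interval_cases k <;> grind
  · have : k < 1 := by omega
    interval_cases k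
    grind
  · have : k < 9 := by omega
    interval_cases k <;> grind
  · have : k < 8 := by omega
    interval_cases k <;> grind

/-- Two consecutive ones come from a long word. -/
theorem translateStart_of_one_one {i : ℕ} (h0 : output i = 1) (h1 : output (i + 1) = 1) :
    ∃ m, translateStart m + 3 < i ∧ i < translateStart m + 6 ∧
      ((entry m = .longA) ∨ (entry m = .longB ∧ i = translateStart m + 4)) := by
  have hi : 0 < i := Nat.pos_of_ne_zero fun h => by simp [h, output_zero] at h0
  obtain ⟨m, hm, hm'⟩ := exists_translateStart_le hi
  obtain ⟨k, hk⟩ := Nat.exists_eq_add_of_le hm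
  have h2 := output_translateStart_sub_one (m + 1)
  refine ⟨m, ?_⟩
  rcases entry_spec m with h | h | h | h
  · have : k < 2 := by omega
    interval_cases k <;> grind
  · have : k < 1 := by omega
    interval_cases k
    grind
  · have : k < 9 := by omega
    interval_cases k <;> grind
  · have : k < 8 := by omega
    interval_cases k <;> grind

/-- In front of a word that starts with `010` the read head accepts a long word. -/
theorem entry_long {n : ℕ} (h0 : output (wordStart n) = 0) (h1 : output (wordStart n + 1) = 1)
    (h2 : output (wordStart n + 2) = 0) : entry n = .longA ∨ entry n = .longB := by
  induction n using Nat.strong_induction_on with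
  | _ n ih =>
    by_contra hn
    have hz : entry n = .zero := by
      rcases entry_spec n with h | h | h | h <;> grind
    -- Bits `010?0` would have been accepted as a long word, so the bits are `010?1`.
    have h4 : output (wordStart n + 4) = 1 := by
      rw [output_eq_one_iff]
      exact fun h4 => not_long_prefix n hz h0 h1 h2 h4
    obtain ⟨m, hm, hm1⟩ := translateStart_of_rise_fall h0 h1 h2
    -- The case `01011`: a pair of ones starts at offset 4 or 5 of a long translate, and neither
    -- place has `10` directly before it.
    by_cases h3 : output (wordStart n + 3) = 1
    · obtain ⟨l, hl1, hl2, hl3⟩ := translateStart_of_one_one h3 h4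
      have hl : output (translateStart l + 2) = 0 ∧ output (translateStart l + 4) = 1 := by
        rcases entry_spec l with h | h | h | h <;> simp_all
      obtain h5 | h5 : wordStart n + 2 = translateStart l + 4 ∨
          wordStart n + 1 = translateStart l + 2 := by omega
      · rw [h5] at h2
        omega
      · rw [h5] at h1
        omega
    · have h3 : output (wordStart n + 3) = 0 := by omega
      -- The case `01001`: the bits `1`, `0` and `0` from the first one on are the translates of `0`
      -- and `1`, and the last one starts the translate of a word beginning with `0`. So `010`
      -- stands at the start of the earlier word `m`, which was read as short: a descent.
      have e1 := entry_spec m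
      have e2 := entry_spec (m + 1)
      have e3 := entry_spec (m + 2)
      have hm0 : entry m = .zero := by grind
      have hlt : m < n := by
        have := translateStart_eq m
        have hz : 0 < zeros (wordStart m) := by
          have : m ≠ 0 := by rintro rfl; simp [entry] at hm0
          have : 1 ≤ wordStart m := (Nat.one_le_iff_ne_zero.2 this).trans (le_wordStart m)
          exact (zeros_mono this).trans_lt' (by decide)
        exact strictMono_wordStart.lt_iff_lt.1 (by omega)
      have hm1 : entry (m + 1) = .one := by
        clear ih e3
        grind
      have hm2 : entry (m + 2) ≠ .one := by
        clear ih
        grind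
      have := ih m hlt
      clear ih
      grind

theorem succ_le_wordStart_succ (n : ℕ) : n + 5 ≤ wordStart (n + 1) := by
  induction n with
  | zero => decide
  | succ n ih =>
    have := (entry (n + 1)).lhs_length_pos
    rw [wordStart]
    omega

/-- The word in front of the index `p + 5`, read backwards. -/
theorem entry_before {n p : ℕ} (h : wordStart (n + 1) = p + 5) :
    (entry n = .zero ∧ wordStart n = p + 4 ∧ output (p + 4) = 0) ∨
    (entry n = .one ∧ wordStart n = p + 4 ∧ output (p + 4) = 1) ∨
    (entry n = .longA ∧ wordStart n = p ∧ output p = 0 ∧ output (p + 1) = 1 ∧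
      output (p + 2) = 0 ∧ output (p + 3) = 0 ∧ output (p + 4) = 0) ∨
    (entry n = .longB ∧ wordStart n = p ∧ output p = 0 ∧ output (p + 1) = 1 ∧
      output (p + 2) = 0 ∧ output (p + 3) = 1 ∧ output (p + 4) = 0) := by
  rcases entry_spec n with h' | h' | h' | h'
  · have e : wordStart n = p + 4 := by omega
    simp_all
  · have e : wordStart n = p + 4 := by omega
    simp_all
  · have e : wordStart n = p := by omega
    simp_all
  · have e : wordStart n = p := by omega
    simp_all

theorem entry_zero : entry 0 = .longA := rfl

/-- The word at index 0 is `01000`; every other word has at least five bits before it. This allows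
looking back by the length of the longest word. -/
theorem exists_succ_of_entry_ne {n : ℕ} (h : entry n ≠ .longA) :
    ∃ k p, n = k + 1 ∧ wordStart n = p + 5 := by
  cases n with
  | zero => exact absurd entry_zero h
  | succ k =>
    have := succ_le_wordStart_succ k
    exact ⟨k, wordStart (k + 1) - 5, rfl, by omega⟩

/-- The translate `10` of a zero followed by three further zeros. -/
theorem entries_of_one_zeros {m : ℕ} (hm : entry m ≠ .one)
    (h2 : output (translateStart m + 2) = 0) (h3 : output (translateStart m + 3) = 0)
    (h4 : output (translateStart m + 4) = 0) :
    entry m = .zero ∧ entry (m + 1) = .one ∧ entry (m + 2) = .one ∧ entry (m + 3) = .one := by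
  have e0 : entry m = .zero ∧ translateStart (m + 1) = translateStart m + 2 := by
    rcases entry_spec m with h | h | h | h
    · exact ⟨h.1, h.2.2.1⟩
    · exact absurd h.1 hm
    all_goals
      have := h4
      simp_all
  have e1 : entry (m + 1) = .one ∧ translateStart (m + 2) = translateStart m + 3 := by
    rw [← e0.2] at h2
    rcases entry_spec (m + 1) with h | h | h | h
    · simp_all
    · exact ⟨h.1, h.2.2.1.trans (by omega)⟩
    all_goals simp_all
  have e2 : entry (m + 2) = .one ∧ translateStart (m + 3) = translateStart m + 4 := by
    rw [← e1.2] at h3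
    rcases entry_spec (m + 2) with h | h | h | h
    · simp_all
    · exact ⟨h.1, h.2.2.1.trans (by omega)⟩
    all_goals simp_all
  refine ⟨e0.1, e1.1, e2.1, ?_⟩
  rw [← e2.2] at h4
  rcases entry_spec (m + 3) with h | h | h | h
  · simp_all
  · exact h.1
  all_goals simp_all

/-- A zero in front of three ones belongs to the translate of `longA`. -/
theorem translateStart_of_one_one_one {i : ℕ} (h1 : output i = 1) (h2 : output (i + 1) = 1)
    (h3 : output (i + 2) = 1) : ∃ l, entry l = .longA ∧ i = translateStart l + 4 := by
  obtain ⟨l, hl1, hl2, hl3⟩ := translateStart_of_one_one h1 h2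
  obtain hi | hi : i = translateStart l + 4 ∨ i = translateStart l + 5 := by omega
  · subst hi
    refine ⟨l, ?_, rfl⟩
    rcases entry_spec l with h | h | h | h <;> simp_all
  · subst hi
    rcases entry_spec l with h | h | h | h <;> simp_all

/-- The three words `1` are the block `111` of a translate `100011100`, so the word `0` before them
is its fourth bit. Reading the first three bits `100` backwards leaves two choices: the words `1`,
`0`, `0`, or a word `01010` ending in the second bit, followed by `0`. -/
theorem entry_before_zero_ones {m : ℕ} (h0 : entry m = .zero) (h1 : entry (m + 1) = .one)
    (h2 : entry (m + 2) = .one) (h3 : entry (m + 3) = .one) :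
    ∃ k, m = k + 2 ∧ entry (k + 1) = .zero ∧
      ((∃ j, k = j + 1 ∧ entry k = .zero ∧ entry j = .one) ∨ entry k = .longB) := by
  obtain ⟨k, r, rfl, hr⟩ := exists_succ_of_entry_ne (n := m) (by simp [h0])
  have f0 := entry_spec (k + 1)
  have f1 := entry_spec (k + 1 + 1)
  have f2 := entry_spec (k + 1 + 2)
  have f3 := entry_spec (k + 1 + 3)
  simp only [h0, h1, h2, h3, reduceCtorEq, false_and, true_and, or_false, false_or] at f0 f1 f2 f3
  rw [hr] at f0
  rw [f0.1] at f1
  rw [f1.1] at f2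
  rw [f2.1] at f3
  obtain ⟨l, hl, hi⟩ := translateStart_of_one_one_one f1.2.2.1 f2.2.2.1 f3.2.2.1
  have fl := entry_spec l
  simp only [hl, reduceCtorEq, false_and, true_and, or_false, false_or] at fl
  have g4 : output (r + 4) = 0 := by
    rw [show r + 4 = translateStart l + 2 by omega]; simp [fl]
  have g3 : output (r + 3) = 0 := by
    rw [show r + 3 = translateStart l + 1 by omega]; simp [fl]
  have g2 : output (r + 2) = 1 := by
    rw [show r + 2 = translateStart l by omega]; simp [fl]
  have b1 : entry k = .zero ∧ wordStart k = r + 4 := by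
    rcases entry_before hr with h | h | h | h <;> simp_all
  obtain ⟨k, r', rfl, hr'⟩ := exists_succ_of_entry_ne (n := k) (by simp [b1])
  obtain rfl : r = r' + 1 := by omega
  refine ⟨k, rfl, b1.1, ?_⟩
  have b2 : (entry k = .zero ∧ wordStart k = r' + 4) ∨ entry k = .longB := by
    rcases entry_before hr' with h | h | h | h <;> simp_all
  refine b2.imp_left fun b2 => ?_
  obtain ⟨j, r'', rfl, hr''⟩ := exists_succ_of_entry_ne (n := k) (by simp [b2])
  obtain rfl : r' = r'' + 1 := by omega
  refine ⟨j, rfl, b2.1, ?_⟩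
  rcases entry_before hr'' with h | h | h | h <;> simp_all

/-- The word `01000` is followed by the word `1`. -/
theorem entry_succ_of_longA {n : ℕ} (hn : entry n = .longA) : entry (n + 1) = .one := by
  by_contra hn1
  have f0 := entry_spec n
  simp only [hn, reduceCtorEq, false_and, true_and, or_false, false_or] at f0
  have h5 : output (wordStart n + 5) = 0 := by
    rw [← f0.1]
    rcases entry_spec (n + 1) with h | h | h | h <;> simp_all
  -- If the next word is not `1`, the bits are `010000`. The one and the four zeros after it are the
  -- translates of `0`, `1`, `1`, `1`, whose predecessors are known.
  obtain ⟨m, hm, hm1⟩ := translateStart_of_rise_fall f0.2.2.1 f0.2.2.2.1 f0.2.2.2.2.1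
  obtain ⟨e0, e1, e2, e3⟩ := entries_of_one_zeros hm1 (by rw [hm]; exact f0.2.2.2.2.2.1)
    (by rw [hm]; exact f0.2.2.2.2.2.2.1) (by rw [hm]; exact h5)
  obtain ⟨k, rfl, ek, hk⟩ := entry_before_zero_ones e0 e1 e2 e3
  have fk := entry_spec (k + 1)
  simp only [ek, reduceCtorEq, false_and, true_and, or_false] at fk
  cases n with
  | zero => simp [entry] at hn1
  | succ n =>
  obtain ⟨t, ht⟩ : ∃ t, wordStart (n + 1) = t + 5 := by
    have := succ_le_wordStart_succ n
    exact ⟨wordStart (n + 1) - 5, by omega⟩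
  have hq2 : translateStart (k + 2) = translateStart (k + 1) + 2 := fk.2.1
  have hq1 : translateStart (k + 1) = t + 4 := by omega
  have g4 : output (t + 4) = 1 := by rw [← hq1]; simp [fk]
  have b1 : entry n = .one ∧ wordStart n = t + 4 := by
    rcases entry_before ht with h | h | h | h <;> simp_all
  obtain ⟨n, t', rfl, ht'⟩ := exists_succ_of_entry_ne (n := n) (by simp [b1])
  obtain rfl : t = t' + 1 := by omega
  have g5 : output (t' + 6) = 0 := by rw [← f0.2.2.1, ht]
  -- A short word here would stand in front of `010`.
  have nz : ¬ (entry n = .zero ∧ wordStart n = t' + 4 ∧ output (t' + 4) = 0) := by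
    rintro ⟨hz, hs, ho⟩
    have := entry_long (n := n) (by rw [hs]; exact ho) (by rw [hs]; exact g4)
      (by rw [hs]; exact g5)
    simp [hz] at this
  -- In both cases the translates of the words before `m` supply bits that fit neither long word at
  -- `t'`.
  rcases hk with ⟨j, rfl, hk0, hj⟩ | hk
  · have fj := entry_spec j
    have fk0 := entry_spec (j + 1)
    simp only [hj, hk0, reduceCtorEq, false_and, true_and, or_false, false_or] at fj fk0
    have o1 : output (t' + 1) = 0 := by
      rw [← output_translateStart_sub_one j]
      congr 1
      omega
    have o3 : output (t' + 3) = 1 := by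
      rw [show t' + 3 = translateStart (j + 1) by omega]; simp [fk0]
    rcases entry_before ht' with h | h | h | h
    · exact nz h
    · have : output (t' + 4) = 0 := by
        rw [show t' + 4 = translateStart (j + 1) + 1 by omega]; simp [fk0]
      simp_all
    · simp_all
    · simp_all
  · have fk0 := entry_spec k
    simp only [hk, reduceCtorEq, false_and, true_and, false_or] at fk0
    have o2 : output (t' + 2) = 1 := by
      rw [show t' + 2 = translateStart k + 5 by omega]; simp [fk0]
    have o3 : output (t' + 3) = 0 := by
      rw [show t' + 3 = translateStart k + 6 by omega]; simp [fk0]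
    have o4 : output (t' + 4) = 0 := by
      rw [show t' + 4 = translateStart k + 7 by omega]; simp [fk0]
    rcases entry_before ht' with h | h | h | h
    · exact nz h
    all_goals simp_all

/-! ### Runs -/

theorem exists_output_zero (i : ℕ) : ∃ j, i ≤ j ∧ j < i + 4 ∧ output j = 0 := by
  by_contra! h
  have h0 : output i = 1 := (output_eq_one_iff _).2 (h i le_rfl (by omega))
  have h1 : output (i + 1) = 1 := (output_eq_one_iff _).2 (h (i + 1) (by omega) (by omega))
  have h2 : output (i + 2) = 1 := (output_eq_one_iff _).2 (h (i + 2) (by omega) (by omega))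
  have h3 : output (i + 3) = 1 := (output_eq_one_iff _).2 (h (i + 3) (by omega) (by omega))
  obtain ⟨l, hl, rfl⟩ := translateStart_of_one_one_one h0 h1 h2
  rcases entry_spec l with h | h | h | h <;> simp_all

theorem exists_entry_ne_one (n : ℕ) : ∃ k, n ≤ k ∧ k < n + 4 ∧ entry k ≠ .one := by
  by_contra! h
  have e0 := entry_spec n
  have e1 := entry_spec (n + 1)
  have e2 := entry_spec (n + 2)
  have e3 := entry_spec (n + 3)
  simp only [h n le_rfl (by omega), h (n + 1) (by omega) (by omega),
    h (n + 2) (by omega) (by omega), h (n + 3) (by omega) (by omega), reduceCtorEq, false_and,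
    true_and, or_false, false_or] at e0 e1 e2 e3
  obtain ⟨j, hj, hj', h0⟩ := exists_output_zero (wordStart n)
  obtain ⟨k, rfl⟩ := Nat.exists_eq_add_of_le hj
  have : k < 4 := by omega
  interval_cases k
  · simp_all
  · rw [← e0.1] at h0; simp_all
  · rw [show wordStart n + 2 = wordStart (n + 2) from (e1.1.trans (by omega)).symm] at h0
    simp_all
  · have h2 : wordStart (n + 2) = wordStart n + 2 := e1.1.trans (by omega)
    rw [show wordStart n + 3 = wordStart (n + 3) from (e2.1.trans (by omega)).symm] at h0
    simp_all

theorem translateStart_add_le (n k : ℕ) : translateStart (n + k) ≤ translateStart n + 9 * k := by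
  induction k with
  | zero => simp
  | succ k ih =>
    have := (entry (n + k)).translate_length_le
    rw [← add_assoc, translateStart]
    omega

/-- Among any four consecutive words one is not `1`, and its translate starts with a one. Translates
have at most nine bits; the bound 45 is not sharp. -/
theorem exists_output_one (i : ℕ) : ∃ j, i ≤ j ∧ j < i + 45 ∧ output j = 1 := by
  obtain ⟨m, hm, hm'⟩ := exists_translateStart_le (Nat.succ_pos i)
  obtain ⟨k, hk, hk', he⟩ := exists_entry_ne_one (m + 1)
  refine ⟨translateStart k, ?_, ?_, ?_⟩
  · have := strictMono_translateStart.monotone hk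
    omega
  · obtain ⟨l, rfl⟩ := Nat.exists_eq_add_of_le (show m ≤ k by omega)
    have := translateStart_add_le m l
    omega
  · rcases entry_spec k with h | h | h | h <;> simp_all

theorem exists_rise {a b : ℕ} (hab : a ≤ b) (ha : output a = 0) (hb : output b = 1) :
    ∃ j, a ≤ j ∧ j < b ∧ output j = 0 ∧ output (j + 1) = 1 := by
  induction b, hab using Nat.le_induction with
  | base => simp [ha] at hb
  | succ b hab ih =>
    by_cases h : output b = 0
    · exact ⟨b, hab, by omega, h, hb⟩
    · obtain ⟨j, hj, hj', h⟩ := ih (by omega)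
      exact ⟨j, hj, by omega, h⟩

/-- The pattern `11` occurs with bounded gaps. -/
theorem exists_one_one (i : ℕ) :
    ∃ j, i ≤ j ∧ j < i + 1000 ∧ output j = 1 ∧ output (j + 1) = 1 := by
  by_contra! hno
  obtain ⟨m, hm, hm'⟩ := exists_translateStart_le (Nat.succ_pos i)
  -- A long word among these seventy would write `11`, and their translates, of at most nine bits
  -- each, start within the excluded range.
  have hlong (k : ℕ) (hk : k < 70) :
      entry (m + 1 + k) = .zero ∨ entry (m + 1 + k) = .one := by
    have h1 := translateStart_add_le m (1 + k)
    rw [← add_assoc] at h1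
    have h2 : translateStart (m + 1) ≤ translateStart (m + 1 + k) :=
      strictMono_translateStart.monotone (by omega)
    have := hno (translateStart (m + 1 + k) + 4) (by omega) (by omega)
    rcases entry_spec (m + 1 + k) with h | h | h | h <;> simp_all
  have hstart (k : ℕ) (hk : k ≤ 70) : wordStart (m + 1 + k) = wordStart (m + 1) + k := by
    induction k with
    | zero => rfl
    | succ k ih =>
      have := ih (by omega)
      have := hlong k (by omega)
      rw [← add_assoc]
      rcases entry_spec (m + 1 + k) with h | h | h | h <;> simp_all <;> omega
  have hpat (j : ℕ) (hj : wordStart (m + 1) ≤ j) (hj' : j < wordStart (m + 1) + 70)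
      (h0 : output j = 0) (h1 : output (j + 1) = 1) (h2 : output (j + 2) = 0) : False := by
    obtain ⟨k, rfl⟩ := Nat.exists_eq_add_of_le hj
    rw [← hstart k (by omega)] at h0 h1 h2
    have := entry_long h0 h1 h2
    rcases hlong k (by omega) with h | h <;> simp [h] at this
  -- The offset 10 leaves room to step back from a pair of ones to the start of its translate.
  obtain ⟨a, ha, ha', h0⟩ := exists_output_zero (wordStart (m + 1) + 10)
  obtain ⟨b, hb, hb', h1⟩ := exists_output_one a
  obtain ⟨j, hj, hj', hj0, hj1⟩ := exists_rise hb h0 h1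
  have hj2 : output (j + 2) = 1 := by
    rw [output_eq_one_iff]
    exact fun h => hpat j (by omega) (by omega) hj0 hj1 h
  -- The pair belongs to a long translate, which starts with `10` after a `0`: the excluded `010`
  -- again.
  obtain ⟨l, hl1, hl2, hl3⟩ := translateStart_of_one_one hj1 hj2
  have hl := output_translateStart_sub_one l
  have hpos : 0 < translateStart l := (Nat.zero_le l).trans_lt (lt_translateStart l)
  refine hpat (translateStart l - 1) (by omega) (by omega) hl ?_ ?_
  · rw [Nat.sub_add_cancel hpos]
    rcases entry_spec l with h | h | h | h <;> simp_all
  · rw [show translateStart l - 1 + 2 = translateStart l + 1 by omega]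
    rcases entry_spec l with h | h | h | h <;> simp_all

/-! ### Synchronization -/

/-- A one that follows a one is read as a word of its own. -/
theorem wordStart_of_one_one {i : ℕ} (h0 : output i = 1) (h1 : output (i + 1) = 1) :
    ∃ n, wordStart n = i + 1 := by
  obtain ⟨n, hn, hn'⟩ := exists_wordStart_le (i + 1)
  refine ⟨n, ?_⟩
  by_contra hne
  obtain ⟨k, hk⟩ := Nat.exists_eq_add_of_le (show wordStart n + 1 ≤ i + 1 by omega)
  obtain rfl : i = wordStart n + k := by omega
  rcases entry_spec n with h | h | h | h
  · omega
  · omega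
  · have : k < 4 := by omega
    clear hk hn hn' hne
    interval_cases k <;> simp_all
  · have : k < 4 := by omega
    clear hk hn hn' hne
    interval_cases k <;> simp_all

/-- By `entry_long`, the bits `010` at a word start force a long word, so five bits determine the
word. -/
theorem entry_eq_of_agree {n n' : ℕ}
    (h : ∀ t < 5, output (wordStart n + t) = output (wordStart n' + t)) : entry n = entry n' := by
  have h0 := h 0 (by norm_num)
  have h1 := h 1 (by norm_num)
  have h2 := h 2 (by norm_num)
  have h3 := h 3 (by norm_num)
  have l := entry_long (n := n)
  have l' := entry_long (n := n')
  rcases entry_spec n with e | e | e | e <;> rcases entry_spec n' with e' | e' | e' | e' <;>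
    simp_all

/-- From a common start on, equal bits are read as equal words. -/
theorem words_agree {n n' r : ℕ}
    (h : ∀ t < r + 5, output (wordStart n + t) = output (wordStart n' + t)) (k : ℕ)
    (hk : wordStart (n + k) ≤ wordStart n + r) :
    wordStart (n' + k) + wordStart n = wordStart (n + k) + wordStart n' ∧
      entry (n + k) = entry (n' + k) := by
  have key (k : ℕ) (hk : wordStart (n + k) ≤ wordStart n + r)
      (he : wordStart (n' + k) + wordStart n = wordStart (n + k) + wordStart n') :
      entry (n + k) = entry (n' + k) := by
    have hle : wordStart n ≤ wordStart (n + k) := strictMono_wordStart.monotone (by omega)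
    refine entry_eq_of_agree fun t ht => ?_
    have := h (wordStart (n + k) - wordStart n + t) (by omega)
    rwa [show wordStart n + (wordStart (n + k) - wordStart n + t) = wordStart (n + k) + t by omega,
      show wordStart n' + (wordStart (n + k) - wordStart n + t) = wordStart (n' + k) + t by omega]
      at this
  suffices he : wordStart (n' + k) + wordStart n = wordStart (n + k) + wordStart n' from
    ⟨he, key k hk he⟩
  induction k with
  | zero => simp [add_comm]
  | succ k ih =>
    have hlt : wordStart (n + k) < wordStart (n + (k + 1)) := strictMono_wordStart (by omega)
    have he := ih (by omega)
    have := key k (by omega) he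
    rw [← add_assoc, ← add_assoc, wordStart, wordStart, this]
    omega

/-- Both windows contain `11` at the same offset, and its second one starts a word in each. -/
theorem exists_common_wordStart {i i' : ℕ}
    (h : ∀ t < 1001, output (i + t) = output (i' + t)) :
    ∃ n n' d, d ≤ 1000 ∧ wordStart n = i + d ∧ wordStart n' = i' + d := by
  obtain ⟨j, hj, hj', h0, h1⟩ := exists_one_one i
  obtain ⟨d, rfl⟩ := Nat.exists_eq_add_of_le hj
  obtain ⟨n, hn⟩ := wordStart_of_one_one h0 h1
  obtain ⟨n', hn'⟩ := wordStart_of_one_one (i := i' + d) (by rw [← h d (by omega), h0])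
    (by rw [add_assoc, ← h (d + 1) (by omega), ← add_assoc, h1])
  exact ⟨n, n', d + 1, by omega, by omega, by omega⟩

/-- The index of the word that covers the bit with index `i`. -/
noncomputable def wordIndex (i : ℕ) : ℕ := (exists_wordStart_le i).choose

theorem wordStart_wordIndex_le (i : ℕ) : wordStart (wordIndex i) ≤ i :=
  (exists_wordStart_le i).choose_spec.1

theorem lt_wordStart_wordIndex_succ (i : ℕ) : i < wordStart (wordIndex i + 1) :=
  (exists_wordStart_le i).choose_spec.2

theorem wordIndex_eq {i n : ℕ} (h : wordStart n ≤ i) (h' : i < wordStart (n + 1)) :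
    wordIndex i = n := by
  have h1 := strictMono_wordStart.lt_iff_lt.1 (h.trans_lt (lt_wordStart_wordIndex_succ i))
  have h2 := strictMono_wordStart.lt_iff_lt.1 ((wordStart_wordIndex_le i).trans_lt h')
  omega

theorem wordIndex_agree {i i' : ℕ} {r : ℕ} (h : ∀ t < r + 1005, output (i + t) = output (i' + t))
    (hr : 1000 ≤ r) :
    i' + r - wordStart (wordIndex (i' + r)) = i + r - wordStart (wordIndex (i + r)) ∧
      entry (wordIndex (i' + r)) = entry (wordIndex (i + r)) := by
  obtain ⟨n, n', d, hd, hn, hn'⟩ := exists_common_wordStart fun t ht => h t (by omega)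
  have hagree (t : ℕ) (ht : t < r - d + 5) :
      output (wordStart n + t) = output (wordStart n' + t) := by
    rw [hn, hn', add_assoc, add_assoc]
    exact h (d + t) (by omega)
  have h1 := wordStart_wordIndex_le (i + r)
  have h2 := lt_wordStart_wordIndex_succ (i + r)
  have hle : n ≤ wordIndex (i + r) := by
    have := strictMono_wordStart.lt_iff_lt.1 ((show wordStart n ≤ i + r by omega).trans_lt h2)
    omega
  obtain ⟨k, hk⟩ := Nat.exists_eq_add_of_le hle
  rw [hk] at h1 h2
  obtain ⟨e1, e2⟩ := words_agree hagree k (by omega)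
  have h3 : wordStart (n' + k + 1) + wordStart n = wordStart (n + k + 1) + wordStart n' := by
    rw [wordStart, wordStart, e2]
    omega
  have hk' : wordIndex (i' + r) = n' + k := wordIndex_eq (by omega) (by omega)
  rw [hk, hk', e2]
  exact ⟨by omega, rfl⟩

theorem readsAt_wordStart {n : ℕ} (hn : 4 ≤ n) :
    dictionary.ReadsAt initialStage (wordStart n) (entry n).lhs := by
  obtain ⟨t, rfl⟩ := Nat.exists_eq_add_of_le' hn
  refine ⟨t, stage t, run_eq_stage t, stage_head t, (entry (t + 4)).translate, ?_⟩
  rw [← stage_head]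
  exact Entry.accepted_eq_read (five_le_length_drop t)

theorem converges_output : dictionary.Converges initialStage output := by
  classical
  let ans (i : ℕ) : ℕ × List (Fin 2) :=
    (i - wordStart (wordIndex i), (entry (wordIndex i)).lhs)
  let win (i : ℕ) : Fin (2 * 1005 + 1) → Fin 2 := fun j => output (i - 1005 + j)
  -- The rule gives the answer at some index with the given window; `wordIndex_agree` makes the
  -- choice irrelevant. The default serves windows that never occur.
  refine ⟨1005, fun f => if h : ∃ i, 1005 ≤ i ∧ win i = f then ans h.choose else default,
    fun i hi => ⟨i - wordStart (wordIndex i), (entry (wordIndex i)).lhs, ?_, ?_, ?_, ?_⟩⟩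
  · have hex : ∃ i', 1005 ≤ i' ∧ win i' = win i := ⟨i, hi, rfl⟩
    change (if h : ∃ i', 1005 ≤ i' ∧ win i' = win i then ans h.choose else default) = ans i
    rw [dif_pos hex]
    obtain ⟨h1, h2⟩ := hex.choose_spec
    generalize hex.choose = i' at h1 h2
    have := wordIndex_agree (i := i - 1005) (i' := i' - 1005) (r := 1005)
      (fun t ht => (congrFun h2 ⟨t, by omega⟩).symm) (by norm_num)
    rw [Nat.sub_add_cancel hi, Nat.sub_add_cancel h1] at this
    exact Prod.ext this.1 (congrArg Entry.lhs this.2)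
  · have := lt_wordStart_wordIndex_succ i
    rw [wordStart] at this
    have := wordStart_wordIndex_le i
    omega
  · exact Nat.sub_le _ _
  · rw [Nat.sub_sub_self (wordStart_wordIndex_le i)]
    refine readsAt_wordStart ?_
    -- The first four words are never read by the process, but they lie at indices below 8, outside
    -- the range of `i`.
    by_contra hlt
    have h1 := lt_wordStart_wordIndex_succ i
    have h2 : wordStart (wordIndex i + 1) ≤ wordStart 4 :=
      strictMono_wordStart.monotone (by omega)
    have h3 : wordStart 4 = 8 := rfl
    omega

/-! ### Candidates for the P-positions, placed word by word. -/

/-- The P-positions above the diagonal that belong to a word, relative to the column in which the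
word starts and the row in which its translate starts. -/
def Entry.cells : Entry → List (ℕ × ℕ)
  | zero => [(0, 0)]
  | one => []
  | longA => [(0, 0), (2, 4), (3, 6), (4, 5)]
  | longB => [(0, 0), (2, 4), (4, 5)]

/-- The cell `(i, j)` of the `n`-th word is at the position `(x, y)`. -/
def CellAt (n x y : ℕ) : Prop :=
  ∃ c ∈ (entry n).cells, x = wordStart n + 1 + c.1 ∧ y = translateStart n + 1 + c.2

/-- The P-positions above the diagonal, as given by the dictionary process. -/
def Upper (x y : ℕ) : Prop := ∃ n, CellAt n x y

/-- The difference of the coordinates of the first cell of the `n`-th word. -/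
def diffStart (n : ℕ) : ℕ := 1 + zeros (wordStart n)

theorem translateStart_eq_add_diffStart (n : ℕ) :
    translateStart n = wordStart n + diffStart n := by
  rw [translateStart_eq, diffStart]; omega

theorem diffStart_spec (n : ℕ) :
    (entry n = .zero ∧ diffStart (n + 1) = diffStart n + 1 ∧ wordStart (n + 1) = wordStart n + 1) ∨
    (entry n = .one ∧ diffStart (n + 1) = diffStart n ∧ wordStart (n + 1) = wordStart n + 1) ∨
    (entry n = .longA ∧ diffStart (n + 1) = diffStart n + 4 ∧
      wordStart (n + 1) = wordStart n + 5) ∨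
    (entry n = .longB ∧ diffStart (n + 1) = diffStart n + 3 ∧
      wordStart (n + 1) = wordStart n + 5) := by
  have h1 := translateStart_eq_add_diffStart n
  have h2 := translateStart_eq_add_diffStart (n + 1)
  rcases entry_spec n with h | h | h | h
  · exact Or.inl ⟨h.1, by omega⟩
  · exact Or.inr (Or.inl ⟨h.1, by omega⟩)
  · exact Or.inr (Or.inr (Or.inl ⟨h.1, by omega⟩))
  · exact Or.inr (Or.inr (Or.inr ⟨h.1, by omega⟩))

theorem diffStart_mono : Monotone diffStart :=
  monotone_nat_of_le_succ fun n => by rcases diffStart_spec n with h | h | h | h <;> omega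

/-- The possible cells of the `n`-th word. -/
theorem CellAt.cases {n x y : ℕ} (h : CellAt n x y) :
    (entry n = .zero ∧ x = wordStart n + 1 ∧ y = x + diffStart n) ∨
    (entry n = .longA ∧ (x = wordStart n + 1 ∧ y = x + diffStart n ∨
      x = wordStart n + 3 ∧ y = x + diffStart n + 2 ∨
      x = wordStart n + 4 ∧ y = x + diffStart n + 3 ∨
      x = wordStart n + 5 ∧ y = x + diffStart n + 1)) ∨
    (entry n = .longB ∧ (x = wordStart n + 1 ∧ y = x + diffStart n ∨
      x = wordStart n + 3 ∧ y = x + diffStart n + 2 ∨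
      x = wordStart n + 5 ∧ y = x + diffStart n + 1)) := by
  have h1 := translateStart_eq_add_diffStart n
  obtain ⟨c, hc, hx, hy⟩ := h
  rcases he : entry n with _ | _ | _ | _ <;> rw [he] at hc <;> simp [Entry.cells] at hc
  · subst hc
    simp at hx hy ⊢
    omega
  · rcases hc with rfl | rfl | rfl | rfl <;> simp at hx hy ⊢ <;> omega
  · rcases hc with rfl | rfl | rfl <;> simp at hx hy ⊢ <;> omega

theorem cellAt_of_mem {n : ℕ} {c : ℕ × ℕ} {e : Entry} (he : entry n = e) (hc : c ∈ e.cells) :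
    CellAt n (wordStart n + 1 + c.1) (wordStart n + diffStart n + 1 + c.2) :=
  ⟨c, he ▸ hc, rfl, by rw [translateStart_eq_add_diffStart]⟩

/-- Successive words occupy successive disjoint intervals of columns and of differences. This
reduces uniqueness to the pattern of a single word. -/
theorem CellAt.bounds {n x y : ℕ} (h : CellAt n x y) :
    wordStart n < x ∧ x ≤ wordStart (n + 1) ∧ x + diffStart n ≤ y ∧ y < x + diffStart (n + 1) := by
  have h' := h.cases
  rcases diffStart_spec n with e | e | e | e <;> simp only [e.1, reduceCtorEq, false_and, true_and,
    or_false, false_or] at h' <;> omega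

theorem CellAt.output_eq {n x y : ℕ} (h : CellAt n x y) :
    output (x - 1) = 0 ∧ output (y - 1) = 1 := by
  obtain ⟨c, hc, rfl, rfl⟩ := h
  rw [add_right_comm _ 1, add_right_comm _ 1, Nat.add_sub_cancel, Nat.add_sub_cancel]
  rcases entry_spec n with e | e | e | e <;> rw [e.1] at hc <;> simp [Entry.cells] at hc
  · simp [hc, e]
  · rcases hc with rfl | rfl | rfl | rfl <;> simp [e]
  · rcases hc with rfl | rfl | rfl <;> simp [e]

theorem eq_of_monotone_of_mem {f : ℕ → ℕ} (hf : Monotone f) {n m v : ℕ} (h1 : f n ≤ v)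
    (h2 : v < f (n + 1)) (h3 : f m ≤ v) (h4 : v < f (m + 1)) : n = m := by
  by_contra hne
  rcases Nat.lt_or_gt_of_ne hne with h | h
  · have := hf (Nat.succ_le_of_lt h)
    simp only [Nat.succ_eq_add_one] at this
    omega
  · have := hf (Nat.succ_le_of_lt h)
    simp only [Nat.succ_eq_add_one] at this
    omega

theorem one_le_diffStart (n : ℕ) : 1 ≤ diffStart n := Nat.le_add_right _ _

theorem Upper.lt {x y : ℕ} (h : Upper x y) : 0 < x ∧ x < y := by
  obtain ⟨n, h⟩ := h
  have := h.bounds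
  have := one_le_diffStart n
  omega

theorem CellAt.eq_of_cellAt {n x y x' y' : ℕ} (h : CellAt n x y) (h' : CellAt n x' y')
    (he : x = x' ∨ y = y' ∨ x + y' = x' + y) : x = x' ∧ y = y' := by
  rcases h.cases with ⟨e, h⟩ | ⟨e, h⟩ | ⟨e, h⟩ <;> rcases h'.cases with ⟨e', h'⟩ | ⟨e', h'⟩ | ⟨e', h'⟩
    <;> first | (rw [e] at e'; cases e'; done) | omega

theorem Upper.eq_of_col {x y y' : ℕ} (h : Upper x y) (h' : Upper x y') : y = y' := by
  obtain ⟨n, h⟩ := h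
  obtain ⟨m, h'⟩ := h'
  have b := h.bounds
  have b' := h'.bounds
  obtain rfl : n = m := eq_of_monotone_of_mem (v := x - 1) strictMono_wordStart.monotone
    (by omega) (by omega) (by omega) (by omega)
  exact (h.eq_of_cellAt h' (Or.inl rfl)).2

theorem Upper.eq_of_diff {x y x' y' : ℕ} (h : Upper x y) (h' : Upper x' y')
    (he : x + y' = x' + y) : x = x' ∧ y = y' := by
  obtain ⟨n, h⟩ := h
  obtain ⟨m, h'⟩ := h'
  have b := h.bounds
  have b' := h'.bounds
  obtain rfl : n = m := eq_of_monotone_of_mem (v := y - x) diffStart_mono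
    (by omega) (by omega) (by omega) (by omega)
  exact h.eq_of_cellAt h' (Or.inr (Or.inr he))

theorem CellAt.row_bounds {n x y : ℕ} (h : CellAt n x y) :
    translateStart n ≤ y - 1 ∧ y - 1 < translateStart (n + 1) := by
  have h' := h.cases
  have h1 := translateStart_eq_add_diffStart n
  have h2 := translateStart_eq_add_diffStart (n + 1)
  rcases diffStart_spec n with e | e | e | e <;> simp only [e.1, reduceCtorEq, false_and, true_and,
    or_false, false_or] at h' <;> omega

theorem Upper.eq_of_row {x y x' : ℕ} (h : Upper x y) (h' : Upper x' y) : x = x' := by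
  obtain ⟨n, h⟩ := h
  obtain ⟨m, h'⟩ := h'
  have b := h.row_bounds
  have b' := h'.row_bounds
  obtain rfl : n = m := eq_of_monotone_of_mem (v := y - 1) strictMono_translateStart.monotone
    b.1 b.2 b'.1 b'.2
  exact (h.eq_of_cellAt h' (Or.inr (Or.inl rfl))).1

theorem not_upper_of_upper {x y z : ℕ} (h : Upper x y) : ¬ Upper y z := by
  obtain ⟨n, h⟩ := h
  rintro ⟨m, h'⟩
  have h1 := h.output_eq.2
  rw [h'.output_eq.1] at h1
  exact absurd h1 (by decide)

theorem exists_upper_col {i : ℕ} (h : output i = 0) : ∃ y, Upper (i + 1) y := by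
  obtain ⟨n, hn, hn'⟩ := exists_wordStart_le i
  obtain ⟨k, rfl⟩ := Nat.exists_eq_add_of_le hn
  suffices ∃ c ∈ (entry n).cells, c.1 = k by
    obtain ⟨c, hc, rfl⟩ := this
    exact ⟨_, n, c, hc, by ring, rfl⟩
  rcases entry_spec n with e | e | e | e
  · have : k < 1 := by omega
    interval_cases k; simp [e, Entry.cells]
  · have : k < 1 := by omega
    interval_cases k; simp_all
  · have : k < 5 := by omega
    interval_cases k <;> simp_all [Entry.cells]
  · have : k < 5 := by omega
    interval_cases k <;> simp_all [Entry.cells]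

theorem exists_upper_row {i : ℕ} (h : output i = 1) : ∃ x, Upper x (i + 1) := by
  have hi : 0 < i := Nat.pos_of_ne_zero fun h0 => by simp [h0, output_zero] at h
  obtain ⟨n, hn, hn'⟩ := exists_translateStart_le hi
  obtain ⟨k, rfl⟩ := Nat.exists_eq_add_of_le hn
  suffices ∃ c ∈ (entry n).cells, c.2 = k by
    obtain ⟨c, hc, rfl⟩ := this
    exact ⟨_, n, c, hc, rfl, by ring⟩
  clear hi hn
  rcases entry_spec n with e | e | e | e
  · have : k < 2 := by omega
    clear hn'
    interval_cases k <;> simp_all [Entry.cells]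
  · have : k < 1 := by omega
    clear hn'
    interval_cases k; simp_all
  · have : k < 9 := by omega
    clear hn'
    interval_cases k <;> simp_all [Entry.cells]
  · have : k < 8 := by omega
    clear hn'
    interval_cases k <;> simp_all [Entry.cells]

/-- The relative differences in the long patterns are 0, 2, 3, 1 and 0, 2, 1, so every word fills
its interval of differences without gaps. -/
theorem exists_upper_diff {d n : ℕ} (h1 : 1 ≤ d) (hn : d < diffStart n) :
    ∃ x, Upper x (x + d) ∧ x ≤ wordStart n := by
  induction n with
  | zero => simp [diffStart, wordStart, zeros] at hn; omega
  | succ n ih =>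
    have hs := strictMono_wordStart (Nat.lt_succ_self n)
    by_cases hd : d < diffStart n
    · obtain ⟨x, hx, hx'⟩ := ih hd
      exact ⟨x, hx, hx'.trans hs.le⟩
    suffices ∃ c ∈ (entry n).cells, diffStart n + c.2 = d + c.1 by
      obtain ⟨c, hc, hcd⟩ := this
      have hc' : CellAt n (wordStart n + 1 + c.1) (wordStart n + 1 + c.1 + d) :=
        ⟨c, hc, rfl, by rw [translateStart_eq_add_diffStart]; omega⟩
      exact ⟨_, ⟨n, hc'⟩, hc'.bounds.2.1⟩
    obtain ⟨k, rfl⟩ := Nat.exists_eq_add_of_le (not_lt.1 hd)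
    rcases diffStart_spec n with e | e | e | e
    · have : k < 1 := by omega
      interval_cases k; simp [e, Entry.cells]
    · omega
    · have : k < 4 := by omega
      interval_cases k <;> simp [e, Entry.cells, add_assoc]
    · have : k < 3 := by omega
      interval_cases k <;> simp [e, Entry.cells, add_assoc]

theorem CellAt.index_le {n m x y x' y' : ℕ} (h : CellAt n x y) (h' : CellAt m x' y')
    (hx : x ≤ x') : n ≤ m := by
  have := (h.bounds.1.trans_le hx).trans_le h'.bounds.2.1
  have := strictMono_wordStart.lt_iff_lt.1 this
  omega

/-- This jump lowers the difference, whereas later words have larger differences; only cells of one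
word need checking. -/
theorem not_upper_jump32 {x y : ℕ} (h : Upper x y) : ¬ Upper (x + 3) (y + 2) := by
  obtain ⟨n, h⟩ := h
  rintro ⟨m, h'⟩
  have b := h.bounds
  have b' := h'.bounds
  rcases (h.index_le h' (by omega)).eq_or_lt with rfl | hlt
  · rcases h.cases with ⟨e, h⟩ | ⟨e, h⟩ | ⟨e, h⟩ <;>
      rcases h'.cases with ⟨e', h'⟩ | ⟨e', h'⟩ | ⟨e', h'⟩ <;>
      first | (rw [e] at e'; cases e'; done) | omega
  · have := diffStart_mono (Nat.succ_le_of_lt hlt)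
    simp only [Nat.succ_eq_add_one] at this
    omega

/-- This jump raises the difference by one and could reach a later word. From a word `0` that
requires the bits `10` next, against `entry_long`. From `01000` it requires a cell in the first
column after the word, against `entry_succ_of_longA`. In `01010` the cell of greatest difference is
in the third column, and the jump stays in the word. -/
theorem not_upper_jump23 {x y : ℕ} (h : Upper x y) : ¬ Upper (x + 2) (y + 3) := by
  obtain ⟨n, h⟩ := h
  rintro ⟨m, h'⟩
  have b := h.bounds
  have b' := h'.bounds
  rcases (h.index_le h' (by omega)).eq_or_lt with rfl | hlt
  · rcases h.cases with ⟨e, h⟩ | ⟨e, h⟩ | ⟨e, h⟩ <;>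
      rcases h'.cases with ⟨e', h'⟩ | ⟨e', h'⟩ | ⟨e', h'⟩ <;>
      first | (rw [e] at e'; cases e'; done) | omega
  · have hd := diffStart_mono (Nat.succ_le_of_lt hlt)
    have hw := strictMono_wordStart.monotone (Nat.succ_le_of_lt hlt)
    simp only [Nat.succ_eq_add_one] at hd hw
    have dn := diffStart_spec n
    have hc := h'.cases
    rcases h.cases with ⟨e, h⟩ | ⟨e, h⟩ | ⟨e, h⟩ <;>
      simp only [e, reduceCtorEq, false_and, true_and, or_false, false_or] at dn
    · have hm : wordStart m = wordStart n + 2 := by omega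
      have hmn : m = n + 2 := by
        have h1 : n + 1 ≠ m := by rintro rfl; omega
        have h3 : wordStart m < wordStart (n + 3) := by
          have := strictMono_wordStart (Nat.lt_succ_self (n + 1))
          have := strictMono_wordStart (Nat.lt_succ_self (n + 2))
          simp only [Nat.succ_eq_add_one, add_assoc, Nat.reduceAdd] at *
          omega
        have := strictMono_wordStart.lt_iff_lt.1 h3
        omega
      subst hmn
      have e1 : entry (n + 1) = .one := by
        have e1 := diffStart_spec (n + 1)
        simp only [add_assoc, Nat.reduceAdd] at e1
        rcases e1 with e1 | e1 | e1 | e1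
        · omega
        · exact e1.1
        all_goals omega
      have o0 := h'.output_eq.1
      have s0 := entry_spec n
      have s1 := entry_spec (n + 1)
      simp only [e, e1, reduceCtorEq, false_and, true_and, or_false, false_or] at s0 s1
      have := entry_long (n := n) s0.2.2.1 (by rw [← s0.1]; exact s1.2.2.1) (by
        rw [← o0]
        congr 1
        omega)
      simp [e] at this
    · have hx : x = wordStart n + 4 := by omega
      have hm : wordStart m = wordStart (n + 1) := by omega
      obtain rfl := strictMono_wordStart.injective hm
      rw [entry_succ_of_longA e] at hc
      simp at hc
    · omega

/-- A position below the P-position of its column has an option that is a P-position. -/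
theorem exists_option_of_lt {x y y' : ℕ} (h : Upper x y') (hxy : x < y) (hy : y < y') :
    (∃ k > 0, k ≤ x ∧ Upper (x - k) (y - k)) ∨ (∃ k > 0, k ≤ x ∧ Upper (x - k) y) ∨
      (2 ≤ x ∧ 3 ≤ y ∧ Upper (x - 2) (y - 3)) := by
  obtain ⟨n, h⟩ := h
  have hb := h.bounds
  -- Smaller differences occur in earlier words and are reached diagonally. The others lie inside
  -- the pattern of the word itself.
  by_cases hd : y - x < diffStart n
  · obtain ⟨x0, h0, hle⟩ := exists_upper_diff (by omega) hd
    refine Or.inl ⟨x - x0, by omega, by omega, ?_⟩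
    convert h0 using 1 <;> omega
  obtain ⟨k, hk⟩ := Nat.exists_eq_add_of_le (not_lt.1 hd)
  have c0 (he : entry n = .longA ∨ entry n = .longB) :
      CellAt n (wordStart n + 1) (wordStart n + diffStart n + 1) := by
    rcases he with he | he
    · exact cellAt_of_mem (c := (0, 0)) he (by simp [Entry.cells])
    · exact cellAt_of_mem (c := (0, 0)) he (by simp [Entry.cells])
  have c2 (he : entry n = .longA ∨ entry n = .longB) :
      CellAt n (wordStart n + 3) (wordStart n + diffStart n + 5) := by
    rcases he with he | he
    · exact cellAt_of_mem (c := (2, 4)) he (by simp [Entry.cells])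
    · exact cellAt_of_mem (c := (2, 4)) he (by simp [Entry.cells])
  have he : entry n = .longA ∨ entry n = .longB := by
    rcases h.cases with ⟨e, h⟩ | ⟨e, h⟩ | ⟨e, h⟩
    · omega
    · exact Or.inl e
    · exact Or.inr e
  have hpos : (x = wordStart n + 3 ∧ k < 2) ∨ (x = wordStart n + 4 ∧ k < 3) ∨
      (x = wordStart n + 5 ∧ k < 1) := by
    rcases h.cases with ⟨e, h⟩ | ⟨e, h⟩ | ⟨e, h⟩ <;> omega
  by_cases hk0 : k = 0
  · refine Or.inl ⟨x - (wordStart n + 1), by omega, by omega, n, ?_⟩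
    convert c0 he using 1 <;> omega
  -- Three holes of the long pattern remain. The first is a jump (2,3) from the first cell, and this
  -- is what pushes the P-position of that column upwards; the other two reach the second cell.
  · obtain ⟨hx, hk1⟩ | ⟨hx, hk1⟩ | ⟨hx, hk1⟩ : (x = wordStart n + 3 ∧ k = 1) ∨
        (x = wordStart n + 4 ∧ k = 1) ∨ (x = wordStart n + 4 ∧ k = 2) := by omega
    · refine Or.inr (Or.inr ⟨by omega, by omega, n, ?_⟩)
      convert c0 he using 1 <;> omega
    · refine Or.inr (Or.inl ⟨1, by omega, by omega, n, ?_⟩)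
      convert c2 he using 1 <;> omega
    · refine Or.inl ⟨1, by omega, by omega, n, ?_⟩
      convert c2 he using 1 <;> omega

/-! ### The candidates are the P-positions. -/

/-- The set of P-positions, as given by the dictionary process. -/
def Kernel (p : ℕ × ℕ) : Prop := p = (0, 0) ∨ Upper p.1 p.2 ∨ Upper p.2 p.1

theorem Kernel.swap {p : ℕ × ℕ} (h : Kernel p) : Kernel p.swap := by
  rcases h with rfl | h | h
  · exact Or.inl rfl
  · exact Or.inr (Or.inr h)
  · exact Or.inr (Or.inl h)

theorem Move.swap {p q : ℕ × ℕ} (h : Move p q) : Move p.swap q.swap := by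
  cases h with
  | horizontal x y k hk => exact .vertical y x k hk
  | vertical x y k hk => exact .horizontal y x k hk
  | diagonal x y k hk => exact .diagonal y x k hk
  | jump23 x y => exact .jump32 y x
  | jump32 x y => exact .jump23 y x

theorem Kernel.eq_of_col {x y y' : ℕ} (h : Kernel (x, y)) (h' : Kernel (x, y')) : y = y' := by
  simp only [Kernel, Prod.mk.injEq] at h h'
  rcases h with ⟨rfl, rfl⟩ | h | h <;> rcases h' with ⟨h1, h2⟩ | h' | h'
  · exact h2.symm
  · exact absurd h'.lt.1 (lt_irrefl 0)
  · exact absurd h'.lt.2 (Nat.not_lt_zero _)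
  · subst h1; exact absurd h.lt.1 (lt_irrefl 0)
  · exact h.eq_of_col h'
  · exact absurd h (not_upper_of_upper h')
  · subst h1; exact absurd h.lt.2 (Nat.not_lt_zero _)
  · exact absurd h' (not_upper_of_upper h)
  · exact h.eq_of_row h'

theorem upper_one_two : Upper 1 2 :=
  ⟨0, cellAt_of_mem (n := 0) (c := (0, 0)) entry_zero (by simp [Entry.cells])⟩

theorem Kernel.not_jump23 {x y : ℕ} (h : Kernel (x, y)) : ¬ Kernel (x + 2, y + 3) := by
  intro h'
  simp only [Kernel, Prod.mk.injEq] at h h'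
  rcases h with ⟨rfl, rfl⟩ | h | h <;> rcases h' with ⟨h1, h2⟩ | h' | h'
  · omega
  -- The position (2,3) is excluded because the difference 1 belongs to (1,2).
  · have := h'.eq_of_diff upper_one_two (by norm_num)
    omega
  · have := h'.lt
    omega
  · omega
  · exact not_upper_jump23 h h'
  · have := h.lt
    have := h'.lt
    omega
  · omega
  · have := h.lt
    have := h'.lt
    omega
  · exact not_upper_jump32 h h'

theorem Kernel.not_diagonal {x y k : ℕ} (hk : 0 < k) (h : Kernel (x, y)) :
    ¬ Kernel (x + k, y + k) := by
  intro h'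
  simp only [Kernel, Prod.mk.injEq] at h h'
  rcases h with ⟨rfl, rfl⟩ | h | h <;> rcases h' with ⟨h1, h2⟩ | h' | h'
  · omega
  · have := h'.lt
    omega
  · have := h'.lt
    omega
  · omega
  · have := h.eq_of_diff h' (by omega)
    omega
  · have := h.lt
    have := h'.lt
    omega
  · omega
  · have := h.lt
    have := h'.lt
    omega
  · have := h.eq_of_diff h' (by omega)
    omega

theorem Kernel.not_move {p q : ℕ × ℕ} (hp : Kernel p) (h : Move p q) : ¬ Kernel q := by
  intro hq
  cases h with
  | horizontal x y k hk =>
    have := hp.swap.eq_of_col hq.swap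
    omega
  | vertical x y k hk =>
    have := hp.eq_of_col hq
    omega
  | diagonal x y k hk => exact hq.not_diagonal hk hp
  | jump23 x y => exact hq.not_jump23 hp
  | jump32 x y => exact hq.swap.not_jump23 hp.swap

theorem exists_move_of_lt {x y : ℕ} (hxy : x < y) (h : ¬ Kernel (x, y)) :
    ∃ q, Move (x, y) q ∧ Kernel q := by
  have vert (z : ℕ) (hz : z < y) : Move (x, y) (x, z) := by
    have := Move.vertical x z (y - z) (by omega)
    rwa [Nat.add_sub_cancel' hz.le] at this
  rcases x with _ | x
  · exact ⟨(0, 0), vert 0 hxy, Or.inl rfl⟩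
  by_cases ho : output x = 0
  · obtain ⟨y', hy'⟩ := exists_upper_col ho
    rcases lt_trichotomy y y' with hlt | rfl | hlt
    · rcases exists_option_of_lt hy' hxy hlt with ⟨k, hk, hkx, hu⟩ | ⟨k, hk, hkx, hu⟩ | ⟨h2, h3, hu⟩
      · refine ⟨(x + 1 - k, y - k), ?_, Or.inr (Or.inl hu)⟩
        have := Move.diagonal (x + 1 - k) (y - k) k hk
        rwa [Nat.sub_add_cancel hkx, Nat.sub_add_cancel (by omega)] at this
      · refine ⟨(x + 1 - k, y), ?_, Or.inr (Or.inl hu)⟩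
        have := Move.horizontal (x + 1 - k) y k hk
        rwa [Nat.sub_add_cancel hkx] at this
      · refine ⟨(x + 1 - 2, y - 3), ?_, Or.inr (Or.inl hu)⟩
        have := Move.jump23 (x + 1 - 2) (y - 3)
        rwa [Nat.sub_add_cancel h2, Nat.sub_add_cancel h3] at this
    · exact absurd (Or.inr (Or.inl hy')) h
    · exact ⟨_, vert y' hlt, Or.inr (Or.inl hy')⟩
  -- A column with bit `1` has its P-position below the diagonal, in reach of a vertical move.
  · obtain ⟨z, hz⟩ := exists_upper_row ((output_eq_one_iff x).2 ho)
    exact ⟨_, vert z (hz.lt.2.trans hxy), Or.inr (Or.inr hz)⟩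

theorem exists_move_of_not_kernel {p : ℕ × ℕ} (h : ¬ Kernel p) : ∃ q, Move p q ∧ Kernel q := by
  obtain ⟨x, y⟩ := p
  rcases lt_trichotomy x y with hxy | rfl | hxy
  · exact exists_move_of_lt hxy h
  · have hx : 0 < x := Nat.pos_of_ne_zero fun h0 => h (Or.inl (by rw [h0]))
    refine ⟨(0, 0), ?_, Or.inl rfl⟩
    have := Move.diagonal 0 0 x hx
    rwa [zero_add] at this
  · obtain ⟨q, hq, hk⟩ := exists_move_of_lt hxy fun h' => h h'.swap
    exact ⟨q.swap, hq.swap, hk.swap⟩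

theorem isP_iff_kernel (p : ℕ × ℕ) : IsP p ↔ Kernel p := by
  induction hn : p.1 + p.2 using Nat.strong_induction_on generalizing p with
  | _ n ih =>
    subst hn
    rw [IsP]
    constructor
    · intro h
      by_contra hk
      obtain ⟨q, hq, hk⟩ := exists_move_of_not_kernel hk
      exact h q hq ((ih _ hq.sum_lt q rfl).2 hk)
    · intro h q hq hP
      exact h.not_move hq ((ih _ hq.sum_lt q rfl).1 hP)

theorem isP_and_le_iff {x y : ℕ} : IsP (x, y) ∧ x ≤ y ↔ (x = 0 ∧ y = 0) ∨ Upper x y := by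
  rw [isP_iff_kernel, Kernel, Prod.mk.injEq]
  constructor
  · rintro ⟨h | h | h, hle⟩
    · exact Or.inl h
    · exact Or.inr h
    · exact absurd h.lt.2 (not_lt.2 hle)
  · rintro (h | h)
    · exact ⟨Or.inl h, by omega⟩
    · exact ⟨Or.inr (Or.inl h), h.lt.2.le⟩

theorem output_eq_bitString : output = bitString := by
  funext i
  rw [bitString, columnBit]
  split_ifs with h
  · obtain ⟨y, hy, hP⟩ := h
    rcases isP_and_le_iff.1 ⟨hP, hy.le⟩ with h | ⟨n, h⟩
    · omega
    · exact h.output_eq.1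
  · rw [output_eq_one_iff]
    intro h0
    obtain ⟨y, hy⟩ := exists_upper_col h0
    exact h ⟨y, hy.lt.2, (isP_and_le_iff.2 (Or.inr hy)).1⟩

/-! ### The output is an automatic sequence in the Fibonacci numeration -/

/-- Every 45 bits contain a one. This saving makes the deviation from the Fibonacci shift contract.
-/
theorem zeros_add_div_le (i k : ℕ) : zeros (i + k) + k / 45 ≤ zeros i + k := by
  induction k using Nat.strong_induction_on with
  | _ k ih =>
    by_cases hk : k < 45
    · have := zeros_add_le i k
      omega
    obtain ⟨l, rfl⟩ := Nat.exists_eq_add_of_le' (not_lt.1 hk)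
    have h1 := ih l (by omega)
    obtain ⟨j, hj, hj', ho⟩ := exists_output_one (i + l)
    obtain ⟨d, rfl⟩ := Nat.exists_eq_add_of_le hj
    have h2 := zeros_add_le (i + l) d
    have h3 := zeros_succ (i + l + d)
    rw [if_neg (by simp [ho])] at h3
    have h4 := zeros_add_le (i + l + d + 1) (44 - d)
    rw [show i + l + d + 1 + (44 - d) = i + (l + 45) by omega] at h4
    omega

theorem add_div_le_zeros (i k : ℕ) : zeros i + k / 4 ≤ zeros (i + k) := by
  induction k using Nat.strong_induction_on with
  | _ k ih =>
    by_cases hk : k < 4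
    · have := zeros_mono (Nat.le_add_right i k)
      omega
    obtain ⟨l, rfl⟩ := Nat.exists_eq_add_of_le' (not_lt.1 hk)
    have h1 := ih l (by omega)
    obtain ⟨j, hj, hj', ho⟩ := exists_output_zero (i + l)
    have h2 := zeros_mono hj
    have h3 := zeros_succ j
    rw [if_pos ho] at h3
    have h4 := zeros_mono (show j + 1 ≤ i + (l + 4) by omega)
    omega

theorem zeros_agree {i i' N : ℕ} (h : ∀ t < N, output (i + t) = output (i' + t)) (t : ℕ)
    (ht : t ≤ N) : zeros (i + t) + zeros i' = zeros (i' + t) + zeros i := by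
  induction t with
  | zero => simp [add_comm]
  | succ t ih =>
    have := ih (by omega)
    rw [← add_assoc, ← add_assoc, zeros_succ, zeros_succ, h t (by omega)]
    omega

/-- Appending the digit `b` to a Fibonacci expansion of the first number shifts the second. -/
def appendDigit (p : ℕ × ℕ) (b : Bool) : ℕ × ℕ := (p.1 + p.2 + b.toNat, p.1)

/-- The number with the given digits (most significant first) in the Fibonacci numeration, and the
number with the digits shifted down by one place. -/
def digitPair (ds : List Bool) : ℕ × ℕ := ds.foldl appendDigit (0, 0)

theorem digitPair_append (ds : List Bool) (b : Bool) :
    digitPair (ds ++ [b]) = appendDigit (digitPair ds) b := by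
  simp [digitPair]

/-- Near a word start `x`, the new number `x + m + b` misses the start of the translate by about the
old deviation. Counting zeros over this distance leaves at most about 44/45 of it, plus a bounded
error from the position inside the word. The bound 450 = 45 · 10 absorbs this error. -/
theorem abs_zeros_sub_appendDigit {p : ℕ × ℕ} (b : Bool)
    (h : |(zeros p.1 : ℤ) - p.2| ≤ 450) :
    |(zeros (appendDigit p b).1 : ℤ) - (appendDigit p b).2| ≤ 450 := by
  obtain ⟨x, m⟩ := p
  simp only [appendDigit]
  simp only [abs_le] at h ⊢
  have hb : b.toNat ≤ 1 := Bool.toNat_le b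
  generalize b.toNat = ε at hb
  have h1 := wordStart_wordIndex_le x
  have h2 := lt_wordStart_wordIndex_succ x
  generalize wordIndex x = n at h1 h2
  rw [wordStart] at h2
  have h3 := (entry n).lhs_length_le
  obtain ⟨r, hr⟩ := Nat.exists_eq_add_of_le h1
  have h4 := zeros_add_le (wordStart n) r
  rw [← hr] at h4
  have h5 := zeros_mono h1
  have h6 := translateStart_eq n
  have h7 := zeros_translateStart n
  rcases le_total (translateStart n) (x + m + ε) with hle | hle
  · obtain ⟨k, hk⟩ := Nat.exists_eq_add_of_le hle
    have h8 := zeros_add_div_le (translateStart n) k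
    have h9 := zeros_mono hle
    rw [hk] at h9 ⊢
    omega
  · obtain ⟨k, hk⟩ := Nat.exists_eq_add_of_le hle
    have h8 := zeros_add_div_le (x + m + ε) k
    have h9 := zeros_mono hle
    rw [← hk] at h8
    omega

theorem abs_zeros_sub_digitPair (ds : List Bool) :
    |(zeros (digitPair ds).1 : ℤ) - (digitPair ds).2| ≤ 450 := by
  induction ds using List.reverseRecOn with
  | nil => simp [digitPair, zeros_zero]
  | append_singleton ds b ih =>
    rw [digitPair_append]
    exact abs_zeros_sub_appendDigit b ih

/-- Where equal words are read, equal translates are written. -/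
theorem translates_agree {n n' r u : ℕ}
    (h : ∀ t < r + 5, output (wordStart n + t) = output (wordStart n' + t))
    (hu : u + 8 + zeros (wordStart n) < r + zeros (wordStart n + r)) :
    output (translateStart n + u) = output (translateStart n' + u) := by
  have hstart (k : ℕ) (hk : wordStart (n + k) ≤ wordStart n + r) :
      translateStart (n' + k) + translateStart n = translateStart (n + k) + translateStart n' := by
    induction k with
    | zero => simp [add_comm]
    | succ k ih =>
      have hlt : wordStart (n + k) < wordStart (n + (k + 1)) := strictMono_wordStart (by omega)
      have e := ih (by omega)
      have := (words_agree h k (by omega)).2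
      rw [← add_assoc, ← add_assoc, translateStart, translateStart, this]
      omega
  have hQ : 0 < translateStart n + u := by
    have := lt_translateStart n
    omega
  obtain ⟨m, hm, hm'⟩ := exists_translateStart_le hQ
  have hnm : n ≤ m := by
    have := strictMono_translateStart.lt_iff_lt.1 ((Nat.le_add_right _ u).trans_lt hm')
    omega
  obtain ⟨k, rfl⟩ := Nat.exists_eq_add_of_le hnm
  have hk : wordStart (n + k) ≤ wordStart n + r := by
    by_contra hlt
    have h1 := wordStart_wordIndex_le (wordStart n + r)
    have h2 := lt_wordStart_wordIndex_succ (wordStart n + r)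
    generalize wordIndex (wordStart n + r) = l at h1 h2
    have hl := strictMono_wordStart.lt_iff_lt.1 (h1.trans_lt (not_le.1 hlt))
    rw [wordStart] at h2
    have h3 := (entry l).lhs_length_le
    have h4 := strictMono_translateStart hl
    have h5 := translateStart_eq l
    have h6 := translateStart_eq n
    have h7 := zeros_add_le (wordStart l) (wordStart n + r - wordStart l)
    rw [Nat.add_sub_cancel' h1] at h7
    omega
  obtain ⟨j, hj⟩ := Nat.exists_eq_add_of_le hm
  rw [translateStart] at hm'
  have he := (words_agree h k hk).2
  have hs := hstart k hk
  rw [hj, show translateStart n' + u = translateStart (n' + k) + j by omega,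
    output_translate _ _ (by omega), output_translate _ _ (by rw [← he]; omega)]
  simp only [he]

/-- The radius of the window that the automaton keeps. -/
abbrev radius : ℕ := 20000

/-- Synchronization costs at most 1000 bits on the left, and the deviation shifts the centre by at
most 450. Since at least every fourth bit is a zero, translating lengthens by a factor of about 5/4,
which at radius 20000 outweighs these losses. -/
theorem window_step {x x' m m' ε : ℕ} (hx : radius ≤ x) (hx' : radius ≤ x')
    (hw : ∀ t < 2 * radius + 1, output (x - radius + t) = output (x' - radius + t))
    (he : (zeros x : ℤ) - m = zeros x' - m') (hb : |(zeros x : ℤ) - m| ≤ 450) (hε : ε ≤ 1) :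
    (∀ t < 2 * radius + 1,
      output (x + m + ε - radius + t) = output (x' + m' + ε - radius + t)) ∧
    (zeros (x + m + ε) : ℤ) - x = zeros (x' + m' + ε) - x' := by
  simp only [radius] at *
  obtain ⟨n, n', d, hd, hn, hn'⟩ := exists_common_wordStart fun t ht => hw t (by omega)
  obtain ⟨a, ha⟩ : ∃ a, a + d = 20000 := ⟨20000 - d, by omega⟩
  have hxa : x = wordStart n + a := by omega
  have hxa' : x' = wordStart n' + a := by omega
  have hagree (t : ℕ) (ht : t < (20000 + a - 4) + 5) :
      output (wordStart n + t) = output (wordStart n' + t) := by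
    rw [hn, hn', add_assoc, add_assoc]
    exact hw (d + t) (by omega)
  have hz := zeros_agree hagree a (by omega)
  rw [← hxa, ← hxa'] at hz
  have hq := translateStart_eq n
  have hq' := translateStart_eq n'
  have hz1 := add_div_le_zeros (wordStart n) a
  have hz2 := add_div_le_zeros (wordStart n + a) (20000 - 4)
  rw [add_assoc, show a + (20000 - 4) = 20000 + a - 4 by omega, ← hxa] at hz2
  rw [← hxa] at hz1
  rw [abs_le] at hb
  obtain ⟨D, hD⟩ : ∃ D, x + m + ε = translateStart n + D + 20000 :=
    ⟨x + m + ε - translateStart n - 20000, by omega⟩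
  have hD' : x' + m' + ε = translateStart n' + D + 20000 := by omega
  have htr (u : ℕ) (hu : u < D + 40001) :
      output (translateStart n + u) = output (translateStart n' + u) :=
    translates_agree hagree (by omega)
  constructor
  · intro t ht
    rw [hD, hD', Nat.add_sub_cancel, Nat.add_sub_cancel, add_assoc, add_assoc]
    exact htr _ (by omega)
  · have hz3 := zeros_agree htr (D + 20000) (by omega)
    have h4 := zeros_translateStart n
    have h5 := zeros_translateStart n'
    rw [hD, hD', add_assoc, add_assoc]
    omega

/-- The information that determines the further course: small numbers are kept as they are, of
larger ones only a window of the output and the deviation of the shifted number. -/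
def code (p : ℕ × ℕ) : (ℕ × ℕ) ⊕ ((Fin (2 * radius + 1) → Fin 2) × ℤ) :=
  if p.1 < radius then .inl p
  else .inr (fun t => output (p.1 - radius + t), zeros p.1 - p.2)

theorem code_eq_cases {p p' : ℕ × ℕ} (h : code p = code p') :
    p = p' ∨ (radius ≤ p.1 ∧ radius ≤ p'.1 ∧
      (∀ t < 2 * radius + 1, output (p.1 - radius + t) = output (p'.1 - radius + t)) ∧
      (zeros p.1 : ℤ) - p.2 = zeros p'.1 - p'.2) := by
  unfold code at h
  split_ifs at h with h1 h2 h2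
  · exact Or.inl (Sum.inl.inj h)
  · rw [Sum.inr.injEq, Prod.mk.injEq] at h
    exact Or.inr ⟨not_lt.1 h1, not_lt.1 h2, fun t ht => congrFun h.1 ⟨t, ht⟩, h.2⟩

/-- The Myhill–Nerode condition: equality of codes is a right congruence on digit strings. -/
theorem code_appendDigit {ds ds' : List Bool} (h : code (digitPair ds) = code (digitPair ds'))
    (b : Bool) : code (digitPair (ds ++ [b])) = code (digitPair (ds' ++ [b])) := by
  rw [digitPair_append, digitPair_append]
  rcases code_eq_cases h with h | ⟨h1, h2, h3, h4⟩
  · rw [h]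
  · obtain ⟨h5, h6⟩ := window_step h1 h2 h3 h4 (abs_zeros_sub_digitPair ds) (Bool.toNat_le b)
    unfold code appendDigit
    rw [if_neg (by dsimp only; omega), if_neg (by dsimp only; omega)]
    exact congrArg Sum.inr (Prod.ext (funext fun t => h5 t t.2) h6)

theorem finite_range_code : (Set.range fun ds => code (digitPair ds)).Finite := by
  have h1 : (Sum.inl '' ((Set.Iio radius) ×ˢ (Set.Iic (radius + 450))) :
      Set ((ℕ × ℕ) ⊕ ((Fin (2 * radius + 1) → Fin 2) × ℤ))).Finite :=
    ((Set.finite_Iio _).prod (Set.finite_Iic _)).image _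
  have h2 : (Sum.inr '' (Set.univ ×ˢ (Set.Icc (-450) 450)) :
      Set ((ℕ × ℕ) ⊕ ((Fin (2 * radius + 1) → Fin 2) × ℤ))).Finite :=
    (Set.finite_univ.prod (Set.finite_Icc _ _)).image _
  refine (h1.union h2).subset ?_
  rintro _ ⟨ds, rfl⟩
  have hb := abs_zeros_sub_digitPair ds
  rw [abs_le] at hb
  dsimp only
  unfold code
  split_ifs with h
  · refine Or.inl ⟨_, ⟨h, ?_⟩, rfl⟩
    have := zeros_add_le 0 (digitPair ds).1
    rw [zero_add, zeros_zero] at this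
    rw [Set.mem_Iic]
    omega
  · exact Or.inr ⟨(_, (zeros (digitPair ds).1 : ℤ) - (digitPair ds).2),
      ⟨Set.mem_univ _, Set.mem_Icc.2 hb⟩, rfl⟩

/-- Positions above the diagonal are transferred between columns with the same code. -/
theorem upper_transfer {p p' : ℕ × ℕ} {y : ℕ} (h1 : radius ≤ p.1) (h2 : radius ≤ p'.1)
    (h3 : ∀ t < 2 * radius + 1, output (p.1 - radius + t) = output (p'.1 - radius + t))
    (h4 : (zeros p.1 : ℤ) - p.2 = zeros p'.1 - p'.2) (hU : Upper p.1 y) :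
    ∃ y', Upper p'.1 y' ∧ (y : ℤ) - (p.1 + p.2 : ℕ) = y' - (p'.1 + p'.2 : ℕ) := by
  obtain ⟨x, m⟩ := p
  obtain ⟨x', m'⟩ := p'
  simp only [radius] at *
  obtain ⟨n, hc⟩ := hU
  have hb := hc.bounds
  have hn : wordIndex (x - 1) = n := wordIndex_eq (by omega) (by omega)
  have hw := wordIndex_agree (i := x - 20000) (i' := x' - 20000) (r := 19999)
    (fun t ht => h3 t (by omega)) (by norm_num)
  rw [show x - 20000 + 19999 = x - 1 by omega, show x' - 20000 + 19999 = x' - 1 by omega, hn] at hw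
  have hle := wordStart_wordIndex_le (x' - 1)
  have hlt := lt_wordStart_wordIndex_succ (x' - 1)
  generalize wordIndex (x' - 1) = n' at hw hle hlt
  rw [wordStart] at hlt
  have h5 := (entry n').lhs_length_le
  obtain ⟨c, hc, rfl, rfl⟩ := hc
  have hz1 := zeros_agree h3 20000 (by norm_num)
  rw [Nat.sub_add_cancel h1, Nat.sub_add_cancel h2] at hz1
  have hz2 := zeros_agree h3 (19999 - c.1) (by omega)
  rw [show wordStart n + 1 + c.1 - 20000 + (19999 - c.1) = wordStart n by omega,
    show x' - 20000 + (19999 - c.1) = wordStart n' by omega] at hz2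
  refine ⟨translateStart n' + 1 + c.2, ⟨n', c, by rwa [hw.2], by omega, rfl⟩, ?_⟩
  have := translateStart_eq n
  have := translateStart_eq n'
  omega

theorem isP_transfer {p p' : ℕ × ℕ} {y : ℕ} (h : code p = code p') (hP : IsP (p.1, y))
    (hle : p.1 ≤ y) :
    ∃ y', (IsP (p'.1, y') ∧ p'.1 ≤ y') ∧ (y : ℤ) - (p.1 + p.2 : ℕ) = y' - (p'.1 + p'.2 : ℕ) := by
  rcases code_eq_cases h with rfl | ⟨h1, h2, h3, h4⟩
  · exact ⟨y, ⟨hP, hle⟩, rfl⟩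
  · rcases isP_and_le_iff.1 ⟨hP, hle⟩ with h0 | hU
    · exact absurd h1 (by rw [h0.1]; decide)
    · obtain ⟨y', hU', hy'⟩ := upper_transfer h1 h2 h3 h4 hU
      exact ⟨y', isP_and_le_iff.2 (Or.inr hU'), hy'⟩

theorem isP_col_unique {x y y' : ℕ} (h : IsP (x, y)) (h' : IsP (x, y')) : y = y' :=
  ((isP_iff_kernel _).1 h).eq_of_col ((isP_iff_kernel _).1 h')

/-- A right congruence with finitely many classes is the state map of a finite automaton. -/
theorem exists_automaton_of_finite_range {Γ : Type} (c : List Bool → Γ)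
    (hfin : (Set.range c).Finite)
    (hcong : ∀ u v b, c u = c v → c (u ++ [b]) = c (v ++ [b])) :
    ∃ (S : Type) (_ : Fintype S) (s₀ : S) (δ : S → Bool → S) (g : S → Γ),
      ∀ u : List Bool, g (u.foldl δ s₀) = c u := by
  refine ⟨Set.range c, hfin.fintype, ⟨c [], [], rfl⟩,
    fun s b => ⟨c (s.2.choose ++ [b]), _, rfl⟩, Subtype.val, fun u => ?_⟩
  induction u using List.reverseRecOn with
  | nil => rfl
  | append_singleton u b ih =>
    rw [List.foldl_append, List.foldl_cons, List.foldl_nil]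
    refine hcong _ _ b ?_
    rw [← ih]
    exact Subtype.prop (p := fun γ => γ ∈ Set.range c) _ |>.choose_spec

/-- A finite automaton that reads the digits of `x` in the Fibonacci numeration finds the deviation
of the height `y` of the P-position in column `x` from the number with the digits of `x` shifted
up by one place. -/
theorem exists_digit_automaton :
    ∃ (S : Type) (_ : Fintype S) (s₀ : S) (δ : S → Bool → S) (out : S → Option ℤ),
      ∀ (ds : List Bool) (y : ℕ), (IsP ((digitPair ds).1, y) ∧ (digitPair ds).1 ≤ y) ↔
        out (ds.foldl δ s₀) = some ((y : ℤ) - ((digitPair ds).1 + (digitPair ds).2 : ℕ)) := by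
  classical
  obtain ⟨S, hS, s₀, δ, g, hg⟩ := exists_automaton_of_finite_range _ finite_range_code
    fun u v b h => code_appendDigit h b
  -- The output of a state is read off any digit string with its code. By `isP_transfer` and
  -- uniqueness in a column, every such string gives the same value.
  let Q (s : S) (c : ℤ) : Prop := ∃ (ds : List Bool) (y : ℕ), code (digitPair ds) = g s ∧
    (IsP ((digitPair ds).1, y) ∧ (digitPair ds).1 ≤ y) ∧
    c = (y : ℤ) - ((digitPair ds).1 + (digitPair ds).2 : ℕ)
  refine ⟨S, hS, s₀, δ, fun s => if h : ∃ c, Q s c then some h.choose else none,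
    fun ds y => ⟨fun h => ?_, fun h => ?_⟩⟩
  · have hex : ∃ c, Q (ds.foldl δ s₀) c := ⟨_, ds, y, (hg ds).symm, h, rfl⟩
    dsimp only
    rw [dif_pos hex]
    obtain ⟨ds', y', h1, h2, h3⟩ := hex.choose_spec
    rw [hg] at h1
    obtain ⟨y'', h4, h5⟩ := isP_transfer h1 h2.1 h2.2
    rw [h3, h5, isP_col_unique h4.1 h.1]
  · dsimp only at h
    split_ifs at h with hex
    obtain ⟨ds', y', h1, h2, h3⟩ := hex.choose_spec
    rw [hg] at h1
    obtain ⟨y'', h4, h5⟩ := isP_transfer h1 h2.1 h2.2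
    rw [Option.some.injEq, h3, h5] at h
    obtain rfl : y'' = y := by omega
    exact h4

/-! ### Sweeping machines -/

/-- A machine that sweeps a finite tape, forward with a finite control and backward with a fixed
map on the cells, until its state carries a verdict. -/
structure Sweeper (A S : Type) where
  /-- the initial state; the machine starts with a backward sweep -/
  start : S
  /-- the forward sweep -/
  fwd : S → A → S × A
  /-- the backward sweep -/
  commit : S → A → A
  /-- the change of state after a backward sweep -/
  turn : S → S
  /-- the verdict after a backward sweep, if the machine is to stop -/
  verdict : S → Option Bool
  /-- the cell for a bit of the first number -/
  cell : Bool → A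
  /-- a bit of the second number is joined to a cell -/
  join : A → Bool → A
  /-- the number of cells appended to the input -/
  pad : ℕ

namespace Sweeper

variable {A S : Type} (P : Sweeper A S)

/-- A complete forward sweep. -/
def fwdList : S → List A → S × List A
  | s, [] => (s, [])
  | s, a :: l => ((fwdList (P.fwd s a).1 l).1, (P.fwd s a).2 :: (fwdList (P.fwd s a).1 l).2)

theorem length_fwdList (s : S) (l : List A) : (P.fwdList s l).2.length = l.length := by
  induction l generalizing s with
  | nil => rfl
  | cons a l ih => simp [fwdList, ih]

/-- The tape for the second number `ys`, when the bits of the first number are on the cells. -/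
def merge : List A → List Bool → List A
  | [], [] => List.replicate P.pad (P.cell false)
  | [], y :: ys => P.join (P.cell false) y :: merge [] ys
  | a :: l, [] => P.join a false :: merge l []
  | a :: l, y :: ys => P.join a y :: merge l ys

/-- From the state `s` and the tape `l` after a backward sweep, the machine stops with the verdict
`b` after `k` rounds. -/
inductive Halts : ℕ → S → List A → Bool → Prop
  | done {s : S} {b : Bool} (l : List A) (h : P.verdict s = some b) : Halts 0 s l b
  | round {k : ℕ} {s : S} {l : List A} {b : Bool} (h : P.verdict s = none)
      (h' : Halts k (P.turn (P.fwdList s l).1)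
        ((P.fwdList s l).2.map (P.commit (P.fwdList s l).1)) b) : Halts (k + 1) s l b

/-- The stacks of the Turing machine. -/
inductive Stack
  | input
  | output
  | left
  | right
  deriving DecidableEq

instance : Fintype Stack := ⟨{.input, .output, .left, .right}, fun x => by cases x <;> simp⟩

/-- The labels of the Turing machine. -/
inductive Label
  | split
  | unsplit
  | join
  | backward
  | forward
  | clear
  deriving DecidableEq

instance : Fintype Label :=
  ⟨{.split, .unsplit, .join, .backward, .forward, .clear}, fun x => by cases x <;> simp⟩

/-- The stack alphabets of the Turing machine. -/
abbrev Alphabet (A : Type) : Stack → Type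
  | .input => Bool ⊕ Bool
  | .output => Bool
  | .left => A
  | .right => A

/-- The internal states of the Turing machine: the state of the sweeping machine, and the last
symbols popped from the tape and from the input. -/
abbrev Control (A S : Type) : Type := S × Option A × Option (Bool ⊕ Bool)

/-- The contents of all stacks. -/
def contents (i : List (Bool ⊕ Bool)) (o : List Bool) (l r : List A) :
    ∀ k : Stack, List (Alphabet A k)
  | .input => i
  | .output => o
  | .left => l
  | .right => r

section contents

variable (i : List (Bool ⊕ Bool)) (o : List Bool) (l r : List A)

@[simp] theorem contents_input : contents i o l r .input = i := rfl
@[simp] theorem contents_output : contents i o l r .output = o := rfl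
@[simp] theorem contents_left : contents i o l r .left = l := rfl
@[simp] theorem contents_right : contents i o l r .right = r := rfl

@[simp] theorem update_contents_input (i' : List (Bool ⊕ Bool)) :
    Function.update (contents i o l r) .input i' = contents i' o l r := by
  funext k; cases k <;> rfl

@[simp] theorem update_contents_output (o' : List Bool) :
    Function.update (contents i o l r) .output o' = contents i o' l r := by
  funext k; cases k <;> rfl

@[simp] theorem update_contents_left (l' : List A) :
    Function.update (contents i o l r) .left l' = contents i o l' r := by
  funext k; cases k <;> rfl

@[simp] theorem update_contents_right (r' : List A) :
    Function.update (contents i o l r) .right r' = contents i o l r' := by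
  funext k; cases k <;> rfl

end contents

/-- The bit of an input symbol, `false` if there is none. -/
def bitOf : Option (Bool ⊕ Bool) → Bool
  | some (.inl b) => b
  | some (.inr b) => b
  | none => false

open Turing.TM2 Turing.TM2.Stmt

/-- Push `n` empty cells. -/
def padStmt (q : Stmt (Alphabet A) Label (Control A S)) :
    ℕ → Stmt (Alphabet A) Label (Control A S)
  | 0 => q
  | n + 1 => push .left (fun _ => P.cell false) (padStmt q n)

/-- The program of the Turing machine. -/
def program : Label → Stmt (Alphabet A) Label (Control A S)
  | .split =>
    peek .input (fun v a => (v.1, v.2.1, a)) <|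
    branch (fun v => v.2.2.any Sum.isLeft)
      (pop .input (fun v _ => v) <|
        push .left (fun v => P.cell (bitOf v.2.2)) <| goto fun _ => .split)
      (goto fun _ => .unsplit)
  | .unsplit =>
    pop .left (fun v a => (v.1, a, v.2.2)) <|
    branch (fun v => v.2.1.isSome)
      (push .right (fun v => v.2.1.getD (P.cell false)) <| goto fun _ => .unsplit)
      (goto fun _ => .join)
  | .join =>
    pop .right (fun v a => (v.1, a, v.2.2)) <|
    pop .input (fun v a => (v.1, v.2.1, a)) <|
    branch (fun v => v.2.1.isSome || v.2.2.isSome)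
      (push .left (fun v => P.join (v.2.1.getD (P.cell false)) (bitOf v.2.2)) <|
        goto fun _ => .join)
      (P.padStmt (goto fun _ => .backward) P.pad)
  | .backward =>
    pop .left (fun v a => (v.1, a, v.2.2)) <|
    branch (fun v => v.2.1.isSome)
      (push .right (fun v => P.commit v.1 (v.2.1.getD (P.cell false))) <| goto fun _ => .backward)
      (load (fun v => (P.turn v.1, v.2)) <|
        goto fun v => if (P.verdict v.1).isSome then .clear else .forward)
  | .forward =>
    pop .right (fun v a => (v.1, a, v.2.2)) <|
    branch (fun v => v.2.1.isSome)
      (push .left (fun v => (P.fwd v.1 (v.2.1.getD (P.cell false))).2) <|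
        load (fun v => ((P.fwd v.1 (v.2.1.getD (P.cell false))).1, v.2)) <|
        goto fun _ => .forward)
      (goto fun _ => .backward)
  | .clear =>
    pop .right (fun v a => (v.1, a, v.2.2)) <|
    branch (fun v => v.2.1.isSome)
      (goto fun _ => .clear)
      (push .output (fun v => (P.verdict v.1).getD false) <|
        -- The required halting configuration has the initial internal state and nothing but the
        -- answer on the stacks.
        load (fun _ => (P.start, none, none)) halt)

/-- The Turing machine of a sweeping machine. -/
def machine [Fintype S] [Fintype A] : Turing.FinTM2 where
  K := Stack
  k₀ := .input
  k₁ := .output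
  Γ := Alphabet A
  Λ := Label
  main := .split
  σ := Control A S
  initialState := (P.start, none, none)
  Γk₀Fin := inferInstanceAs (Fintype (Bool ⊕ Bool))
  m := P.program

/-- The configurations of the Turing machine. -/
abbrev Config (A S : Type) : Type := Cfg (Alphabet A) Label (Control A S)

/-- The machine gets from one configuration to another one in `n` steps. -/
def Steps (n : ℕ) (c c' : Config A S) : Prop :=
  (flip bind (step P.program))^[n] (some c) = some c'

variable {P}

theorem Steps.refl (c : Config A S) : P.Steps 0 c c := rfl

theorem Steps.head {n : ℕ} {c c' c'' : Config A S} (h : step P.program c = some c')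
    (h' : P.Steps n c' c'') : P.Steps (n + 1) c c'' := by
  rw [Steps, Function.iterate_succ_apply]
  change (flip bind (step P.program))^[n] (step P.program c) = _
  rw [h]
  exact h'

theorem Steps.single {c c' : Config A S} (h : step P.program c = some c') : P.Steps 1 c c' :=
  Steps.head h (Steps.refl _)

theorem Steps.trans {n m : ℕ} {c c' c'' : Config A S} (h : P.Steps n c c')
    (h' : P.Steps m c' c'') : P.Steps (n + m) c c'' := by
  rw [Steps, add_comm, Function.iterate_add_apply, h]
  exact h'

variable (P)

theorem steps_split (xs : List Bool) (ys : List Bool) (s : S) (c : Option A)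
    (t : Option (Bool ⊕ Bool)) (l : List A) :
    ∃ t', P.Steps (xs.length + 1)
      ⟨some .split, (s, c, t), contents (xs.map .inl ++ ys.map .inr) [] l []⟩
      ⟨some .unsplit, (s, c, t'), contents (ys.map .inr) [] ((xs.map P.cell).reverse ++ l) []⟩ := by
  induction xs generalizing t l with
  | nil =>
    refine ⟨(ys.map (Sum.inr : Bool → Bool ⊕ Bool)).head?, Steps.single ?_⟩
    cases ys <;> simp [program]
  | cons x xs ih =>
    obtain ⟨t', h⟩ := ih (some (.inl x)) (P.cell x :: l)
    refine ⟨t', Steps.head (c' := ?_) ?_ (by simpa using h)⟩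
    simp [program, bitOf]

theorem steps_unsplit (i : List (Bool ⊕ Bool)) (s : S) (c : Option A)
    (t : Option (Bool ⊕ Bool)) (l r : List A) :
    P.Steps (l.length + 1) ⟨some .unsplit, (s, c, t), contents i [] l r⟩
      ⟨some .join, (s, none, t), contents i [] [] (l.reverse ++ r)⟩ := by
  induction l generalizing c r with
  | nil => exact Steps.single (by simp [program])
  | cons a l ih =>
    have h := ih (some a) (a :: r)
    refine Steps.head (c' := ?_) ?_ (by simpa using h)
    simp [program]

theorem stepAux_padStmt (q : Stmt (Alphabet A) Label (Control A S)) (n : ℕ) (v : Control A S)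
    (i : List (Bool ⊕ Bool)) (o : List Bool) (l r : List A) :
    stepAux (P.padStmt q n) v (contents i o l r) =
      stepAux q v (contents i o (List.replicate n (P.cell false) ++ l) r) := by
  induction n generalizing l with
  | zero => rfl
  | succ n ih =>
    simp only [padStmt, stepAux, contents_left, update_contents_left]
    rw [ih, List.replicate_succ', List.append_assoc]
    rfl

theorem steps_join (ys : List Bool) (s : S) (c : Option A) (t : Option (Bool ⊕ Bool))
    (l r : List A) :
    P.Steps (max r.length ys.length + 1)
      ⟨some .join, (s, c, t), contents (ys.map .inr) [] l r⟩
      ⟨some .backward, (s, none, none), contents [] [] ((P.merge r ys).reverse ++ l) []⟩ := by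
  induction ys generalizing c t l r with
  | nil =>
    induction r generalizing c t l with
    | nil => exact Steps.single (by simp [program, stepAux_padStmt, merge])
    | cons a r ih =>
      have h := ih (some a) none (P.join a false :: l)
      simp only [List.length_nil, Nat.max_zero, List.length_cons] at h ⊢
      refine Steps.head (c' := ?_) ?_ (by simpa [merge] using h)
      simp [program, bitOf]
  | cons y ys ih =>
    cases r with
    | nil =>
      have h := ih none (some (.inr y)) (P.join (P.cell false) y :: l) []
      simp only [List.length_nil, Nat.zero_max, List.length_cons] at h ⊢
      refine Steps.head (c' := ?_) ?_ (by simpa [merge] using h)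
      simp [program, bitOf]
    | cons a r =>
      have h := ih (some a) (some (.inr y)) (P.join a y :: l) r
      simp only [List.length_cons, Nat.succ_max_succ] at h ⊢
      refine Steps.head (c' := ?_) ?_ (by simpa [merge] using h)
      simp [program, bitOf]

/-- The label after a backward sweep. -/
def resume (s : S) : Label := if (P.verdict s).isSome then .clear else .forward

theorem steps_backward (s : S) (c : Option A) (l r : List A) :
    P.Steps (l.length + 1) ⟨some .backward, (s, c, none), contents [] [] l r⟩
      ⟨some (P.resume (P.turn s)), (P.turn s, none, none),
        contents [] [] [] ((l.map (P.commit s)).reverse ++ r)⟩ := by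
  induction l generalizing c r with
  | nil => exact Steps.single (by simp [program, resume])
  | cons a l ih =>
    have h := ih (some a) (P.commit s a :: r)
    refine Steps.head (c' := ?_) ?_ (by simpa using h)
    simp [program]

theorem steps_forward (s : S) (c : Option A) (l r : List A) :
    P.Steps (r.length + 1) ⟨some .forward, (s, c, none), contents [] [] l r⟩
      ⟨some .backward, ((P.fwdList s r).1, none, none),
        contents [] [] ((P.fwdList s r).2.reverse ++ l) []⟩ := by
  induction r generalizing s c l with
  | nil => exact Steps.single (by simp [program, fwdList])
  | cons a r ih =>
    have h := ih (P.fwd s a).1 (some a) ((P.fwd s a).2 :: l)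
    refine Steps.head (c' := ?_) ?_ (by simpa [fwdList] using h)
    simp [program]

theorem steps_clear {s : S} {b : Bool} (hb : P.verdict s = some b) (c : Option A) (r : List A) :
    P.Steps (r.length + 1) ⟨some .clear, (s, c, none), contents [] [] [] r⟩
      ⟨none, (P.start, none, none), contents [] [b] [] []⟩ := by
  induction r generalizing c with
  | nil => exact Steps.single (by simp [program, hb])
  | cons a r ih =>
    refine Steps.head (n := r.length + 1)
      (c' := ⟨some .clear, (s, some a, none), contents [] [] [] r⟩) ?_ (ih (some a))
    simp [program]

theorem Halts.steps {k : ℕ} {s : S} {l : List A} {b : Bool} (h : P.Halts k s l b) :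
    P.Steps (k * (2 * l.length + 2) + (l.length + 1))
      ⟨some (P.resume s), (s, none, none), contents [] [] [] l⟩
      ⟨none, (P.start, none, none), contents [] [b] [] []⟩ := by
  induction h with
  | done l h =>
    rw [resume, h, zero_mul, zero_add]
    exact P.steps_clear h none l
  | @round k s l b h _ ih =>
    have h1 := P.steps_forward s none [] l
    have h2 := P.steps_backward (P.fwdList s l).1 none ((P.fwdList s l).2.reverse ++ []) []
    rw [List.length_map, length_fwdList] at ih
    have hr : P.resume s = .forward := by simp [resume, h]
    rw [hr]
    have h3 := (h1.trans h2).trans (by simpa using ih)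
    convert h3 using 1
    simp [length_fwdList]
    ring

theorem length_merge (l : List A) (ys : List Bool) :
    (P.merge l ys).length = max l.length ys.length + P.pad := by
  induction l generalizing ys with
  | nil =>
    induction ys with
    | nil => simp [merge]
    | cons y ys ih => simp [merge, ih]; omega
  | cons a l ih =>
    cases ys with
    | nil => simp [merge, ih]; omega
    | cons y ys => simp [merge, ih]; omega

theorem steps_of_halts {xs ys : List Bool} {k : ℕ} {b : Bool}
    (h : P.Halts k (P.turn P.start) ((P.merge (xs.map P.cell) ys).map (P.commit P.start)) b) :
    ∃ n ≤ (2 * k + 10) * (xs.length + ys.length + P.pad + 1),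
      P.Steps n ⟨some .split, (P.start, none, none), contents (xs.map .inl ++ ys.map .inr) [] [] []⟩
        ⟨none, (P.start, none, none), contents [] [b] [] []⟩ := by
  obtain ⟨t, h1⟩ := P.steps_split xs ys P.start none none []
  rw [List.append_nil] at h1
  have h2 := P.steps_unsplit (ys.map .inr) P.start none t (xs.map P.cell).reverse []
  rw [List.reverse_reverse, List.append_nil] at h2
  have h3 := P.steps_join ys P.start none t [] (xs.map P.cell)
  have h4 := P.steps_backward P.start none ((P.merge (xs.map P.cell) ys).reverse ++ []) []
  have h5 := h.steps
  refine ⟨_, ?_, (((h1.trans h2).trans h3).trans h4).trans (by simpa using h5)⟩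
  have hl := P.length_merge (xs.map P.cell) ys
  simp only [List.length_reverse, List.length_map, List.append_nil] at hl ⊢
  rw [hl]
  have hm : max xs.length ys.length ≤ xs.length + ys.length := by omega
  generalize max xs.length ys.length = m at hm
  have : k * (2 * (m + P.pad) + 2) ≤ k * (2 * (xs.length + ys.length + P.pad + 1)) :=
    Nat.mul_le_mul_left _ (by omega)
  linarith

theorem initList_machine [Fintype S] [Fintype A] (i : List (Bool ⊕ Bool)) :
    Turing.initList P.machine i =
      (⟨some .split, (P.start, none, none), contents i [] [] []⟩ : Config A S) := by
  unfold Turing.initList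
  congr 1
  funext k
  cases k <;> rfl

theorem haltList_machine [Fintype S] [Fintype A] (o : List Bool) :
    Turing.haltList P.machine o =
      (⟨none, (P.start, none, none), contents [] o [] []⟩ : Config A S) := by
  unfold Turing.haltList
  congr 1
  funext k
  cases k <;> rfl

/-- A sweeping machine that stops after a linear number of rounds gives a Turing machine that
decides in polynomial time. -/
theorem computableInPolyTime [Fintype S] [Fintype A] (f : ℕ × ℕ → Bool) (K : ℕ)
    (h : ∀ x y : ℕ, ∃ k ≤ K * ((Computability.encodeNat x).length +
        (Computability.encodeNat y).length + 1),
      P.Halts k (P.turn P.start)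
        ((P.merge ((Computability.encodeNat x).map P.cell) (Computability.encodeNat y)).map
          (P.commit P.start)) (f (x, y))) :
    Nonempty (Turing.TM2ComputableInPolyTime
      (Computability.encodingProd Computability.encodingNatBool
        Computability.encodingNatBool).encode Computability.encodeBool f) := by
  have key (p : ℕ × ℕ) : ∃ n ≤ ((2 * Polynomial.C K + 10) *
      (Polynomial.X + Polynomial.C (P.pad + 1)) ^ 2).eval
        ((Computability.encodingProd Computability.encodingNatBool
          Computability.encodingNatBool).encode p).length,
      P.Steps n ⟨some .split, (P.start, none, none), contents
        ((Computability.encodingProd Computability.encodingNatBool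
          Computability.encodingNatBool).encode p) [] [] []⟩
        ⟨none, (P.start, none, none), contents [] [f p] [] []⟩ := by
    obtain ⟨x, y⟩ := p
    obtain ⟨k, hk, hh⟩ := h x y
    obtain ⟨n, hn, hs⟩ := P.steps_of_halts hh
    refine ⟨n, hn.trans ?_, hs⟩
    have hlen : ((Computability.encodingProd Computability.encodingNatBool
        Computability.encodingNatBool).encode (x, y)).length =
        (Computability.encodeNat x).length + (Computability.encodeNat y).length := by
      simp [Computability.encodingProd, Computability.encodingNatBool]
    rw [hlen]
    generalize (Computability.encodeNat x).length + (Computability.encodeNat y).length = N at hk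
    have h10 : Polynomial.eval N (10 : Polynomial ℕ) = 10 := Polynomial.eval_ofNat _ _
    have h2 : Polynomial.eval N (2 : Polynomial ℕ) = 2 := Polynomial.eval_ofNat _ _
    simp only [Polynomial.eval_mul, Polynomial.eval_add, Polynomial.eval_pow, Polynomial.eval_X,
      Polynomial.eval_C, h10, h2]
    rw [sq, ← mul_assoc, ← add_assoc]
    refine Nat.mul_le_mul_right _ ?_
    have : K * (N + 1) ≤ K * (N + P.pad + 1) := Nat.mul_le_mul_left _ (by omega)
    nlinarith
  choose n hn hs using key
  refine ⟨⟨⟨P.machine, Equiv.refl _, Equiv.refl _⟩, _, fun p => ⟨⟨n p, ?_⟩, hn p⟩⟩⟩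
  have h1 := hs p
  have e1 (i : List (Bool ⊕ Bool)) : i.map (Equiv.refl (Bool ⊕ Bool)).invFun = i := List.map_id i
  have e2 (o : List Bool) : o.map (Equiv.refl Bool).invFun = o := List.map_id o
  rw [Steps, ← initList_machine, ← haltList_machine,
    ← e1 (Computability.Encoding.encode _ p), ← e2 [f p]] at h1
  exact h1

end Sweeper

/-! ### Fibonacci numeration on binary tapes -/

/-- The number with the given bits, least significant first. -/
def bitsVal : List Bool → ℕ
  | [] => 0
  | b :: l => b.toNat + 2 * bitsVal l

theorem bitsVal_lt (l : List Bool) : bitsVal l < 2 ^ l.length := by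
  induction l with
  | nil => simp [bitsVal]
  | cons b l ih =>
    have := Bool.toNat_le b
    rw [bitsVal, List.length_cons, pow_succ]
    omega

theorem bitsVal_encodePosNum (n : PosNum) : bitsVal (Computability.encodePosNum n) = (n : ℕ) := by
  induction n with
  | one => rfl
  | bit0 n ih => simp [Computability.encodePosNum, bitsVal, ih, PosNum.cast_bit0]; omega
  | bit1 n ih => simp [Computability.encodePosNum, bitsVal, ih, PosNum.cast_bit1]; omega

theorem bitsVal_encodeNat (n : ℕ) : bitsVal (Computability.encodeNat n) = n := by
  have h (m : Num) : bitsVal (Computability.encodeNum m) = (m : ℕ) := by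
    cases m with
    | zero => rfl
    | pos m => exact bitsVal_encodePosNum m
  rw [Computability.encodeNat, h, Num.to_of_nat]

/-- A cell of the tape: a bit each of the two numbers `x`, `y` and of two consecutive Fibonacci
numbers `f`, `g`, and of the results `x - f`, `y - g`, `f + g`, `g - f`. -/
structure Cell where
  x : Bool
  y : Bool
  f : Bool
  g : Bool
  xf : Bool
  yg : Bool
  sum : Bool
  gf : Bool

instance : Finite Cell :=
  Finite.of_injective
    (fun a => (a.x, a.y, a.f, a.g, a.xf, a.yg, a.sum, a.gf) :
      Cell → Bool × Bool × Bool × Bool × Bool × Bool × Bool × Bool)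
    fun a b h => by cases a; cases b; simp_all

/-- The carry bits of the computation of `x - f`, `y - g`, `f + g`, `g - f`, and whether a bit of
`f` was set. -/
structure Carry where
  xf : Bool
  yg : Bool
  sum : Bool
  gf : Bool
  nonzero : Bool

instance : Finite Carry :=
  Finite.of_injective
    (fun r => (r.xf, r.yg, r.sum, r.gf, r.nonzero) : Carry → Bool × Bool × Bool × Bool × Bool)
    fun a b h => by cases a; cases b; simp_all

/-- No carry. -/
def Carry.zero : Carry := ⟨false, false, false, false, false⟩

@[simp] theorem Carry.zero_xf : Carry.zero.xf = false := rfl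
@[simp] theorem Carry.zero_yg : Carry.zero.yg = false := rfl
@[simp] theorem Carry.zero_sum : Carry.zero.sum = false := rfl
@[simp] theorem Carry.zero_gf : Carry.zero.gf = false := rfl

/-- The borrow bit of `a - b - c`. -/
def borrow (a b c : Bool) : Bool := (!a && (b || c)) || (b && c)

/-- The carry bit of `a + b + c`. -/
def carry (a b c : Bool) : Bool := (a && (b || c)) || (b && c)

theorem borrow_spec (a b c : Bool) :
    (a ^^ b ^^ c).toNat + b.toNat + c.toNat = a.toNat + 2 * (borrow a b c).toNat := by
  cases a <;> cases b <;> cases c <;> rfl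

theorem carry_spec (a b c : Bool) :
    (a ^^ b ^^ c).toNat + 2 * (carry a b c).toNat = a.toNat + b.toNat + c.toNat := by
  cases a <;> cases b <;> cases c <;> rfl

/-- The arithmetic on one cell. -/
def arith (r : Carry) (a : Cell) : Carry × Cell :=
  (⟨borrow a.x a.f r.xf, borrow a.y a.g r.yg, carry a.f a.g r.sum, borrow a.g a.f r.gf,
      r.nonzero || a.f⟩,
    { a with
      xf := a.x ^^ a.f ^^ r.xf
      yg := a.y ^^ a.g ^^ r.yg
      sum := a.f ^^ a.g ^^ r.sum
      gf := a.g ^^ a.f ^^ r.gf })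

/-- The arithmetic on a tape. -/
def arithList : Carry → List Cell → Carry × List Cell
  | r, [] => (r, [])
  | r, a :: l => ((arithList (arith r a).1 l).1, (arith r a).2 :: (arithList (arith r a).1 l).2)

/-- The number on a track of the tape. -/
def track (t : Cell → Bool) (l : List Cell) : ℕ := bitsVal (l.map t)

theorem track_cons (t : Cell → Bool) (a : Cell) (l : List Cell) :
    track t (a :: l) = (t a).toNat + 2 * track t l := rfl

theorem track_map (t : Cell → Bool) (φ : Cell → Cell) (l : List Cell) :
    track t (l.map φ) = track (fun a => t (φ a)) l := by
  rw [track, List.map_map]; rfl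

theorem track_lt (t : Cell → Bool) (l : List Cell) : track t l < 2 ^ l.length := by
  have := bitsVal_lt (l.map t)
  rwa [List.length_map] at this

theorem two_pow_succ_mul (n c : ℕ) : 2 ^ (n + 1) * c = 2 * (2 ^ n * c) := by ring

/-- Schoolbook arithmetic: a final carry or borrow weighs `2 ^ l.length`. Subtrahends are moved to
the other side to stay in the natural numbers. -/
theorem arithList_spec (r : Carry) (l : List Cell) :
    (arithList r l).2.length = l.length ∧
    track Cell.x (arithList r l).2 = track Cell.x l ∧
    track Cell.y (arithList r l).2 = track Cell.y l ∧
    track Cell.f (arithList r l).2 = track Cell.f l ∧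
    track Cell.g (arithList r l).2 = track Cell.g l ∧
    track Cell.xf (arithList r l).2 + track Cell.f l + r.xf.toNat =
      track Cell.x l + 2 ^ l.length * (arithList r l).1.xf.toNat ∧
    track Cell.yg (arithList r l).2 + track Cell.g l + r.yg.toNat =
      track Cell.y l + 2 ^ l.length * (arithList r l).1.yg.toNat ∧
    track Cell.sum (arithList r l).2 + 2 ^ l.length * (arithList r l).1.sum.toNat =
      track Cell.f l + track Cell.g l + r.sum.toNat ∧
    track Cell.gf (arithList r l).2 + track Cell.f l + r.gf.toNat =
      track Cell.g l + 2 ^ l.length * (arithList r l).1.gf.toNat ∧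
    (arithList r l).1.nonzero = (r.nonzero || decide (track Cell.f l ≠ 0)) := by
  induction l generalizing r with
  | nil => simp [arithList, track, bitsVal]
  | cons a l ih =>
    obtain ⟨h1, h2, h3, h4, h5, h6, h7, h8, h9, h10⟩ := ih (arith r a).1
    have e1 := borrow_spec a.x a.f r.xf
    have e2 := borrow_spec a.y a.g r.yg
    have e3 := carry_spec a.f a.g r.sum
    have e4 := borrow_spec a.g a.f r.gf
    simp only [arithList, track_cons, List.length_cons, two_pow_succ_mul]
    simp only [arith] at h1 h2 h3 h4 h5 h6 h7 h8 h9 h10 ⊢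
    refine ⟨by omega, by omega, by omega, by omega, by omega, by omega, by omega, by omega,
      by omega, ?_⟩
    have key (u : Bool) (t : ℕ) : (u || decide (t ≠ 0)) = decide (u.toNat + 2 * t ≠ 0) := by
      cases u <;> simp
    rw [h10, Bool.or_assoc, key]
    congr

/-- The contents of the tape. -/
structure Tape (l : List Cell) (n x y f g : ℕ) : Prop where
  length : l.length = n
  x : track Cell.x l = x
  y : track Cell.y l = y
  f : track Cell.f l = f
  g : track Cell.g l = g

/-! ### The machine that decides P-positions. -/

/-- The bounded integers. -/
abbrev Bounded (C : ℕ) : Type := Set.Icc (-(C : ℤ)) C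

/-- The floor of the half of a bounded integer. -/
def Bounded.half {C : ℕ} (c : Bounded C) : Bounded C :=
  ⟨c.1 / 2, by have := c.2; simp only [Set.mem_Icc] at this ⊢; omega⟩

/-- The states of the machine that decides whether a position is a P-position. -/
inductive Phase (S : Type) (C : ℕ)
  | load
  | order (first lt : Bool)
  | up (r : Carry)
  | down (s : S) (r : Carry)
  | check (ok : Bool) (c : Bounded C)
  | done (b : Bool)

instance {S : Type} {C : ℕ} [Finite S] : Finite (Phase S C) := by
  let φ : Phase S C → Unit ⊕ (Bool × Bool) ⊕ Carry ⊕ (S × Carry) ⊕ (Bool × Bounded C) ⊕ Bool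
    | .load => .inl ()
    | .order u v => .inr (.inl (u, v))
    | .up r => .inr (.inr (.inl r))
    | .down s r => .inr (.inr (.inr (.inl (s, r))))
    | .check u c => .inr (.inr (.inr (.inr (.inl (u, c)))))
    | .done b => .inr (.inr (.inr (.inr (.inr b))))
  refine Finite.of_injective φ ?_
  intro p q h
  cases p <;> cases q <;> simp_all [φ]

variable {S : Type} {C : ℕ}

/-- The machine that decides whether a position is a P-position: it orders the two coordinates,
finds the digits of the smaller one in the Fibonacci numeration, subtracts the shifted number from
the larger one, and compares the rest with the output of the automaton that reads the digits. -/
def decider (s₀ : S) (δ : S → Bool → S) (out : S → Option (Bounded C)) (pad : ℕ) :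
    Sweeper Cell (Phase S C) where
  start := .load
  fwd
    | .order first lt, a => (.order false (borrow a.y a.x lt), { a with g := first })
    | .up r, a => (.up (arith r a).1, (arith r a).2)
    | .down s r, a => (.down s (arith r a).1, (arith r a).2)
    -- The bits of `y` are compared with those of `c`, in two's complement and least significant
    -- first.
    | .check ok c, a => (.check (ok && (a.y == decide (c.1 % 2 = 1))) c.half, a)
    | q, a => (q, a)
  commit
    | .order _ lt, a => if lt then { a with x := a.y, y := a.x } else a
    | .up r, a => if r.xf then a else { a with f := a.g, g := a.sum }
    | .down _ r, a =>
      if r.nonzero then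
        { a with
          x := if r.xf then a.x else a.xf
          -- A digit of weight `f = fib (j + 1)` contributes `fib (j + 1) + fib j = g` to the sum of
          -- a number and its shift down. So `y` loses `g` exactly when `x` loses `f`.
          y := if r.xf then a.y else a.yg
          f := a.gf
          g := a.f }
      else a
    | _, a => a
  turn
    | .load => .order true false
    | .order _ _ => .up .zero
    | .up r => if r.xf then .down s₀ .zero else .up .zero
    | .down s r =>
      if r.nonzero then .down (δ s (!r.xf)) .zero
      else match out s with
        | none => .check false ⟨0, by simp⟩
        | some c => .check true c
    | .check ok _ => .done ok
    | .done b => .done b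
  verdict
    | .done b => some b
    | _ => none
  cell b := ⟨b, false, false, false, false, false, false, false⟩
  join a b := { a with y := b }
  pad := pad

variable {s₀ : S} {δ : S → Bool → S} {out : S → Option (Bounded C)} {pad : ℕ}
  {l : List Cell} {n x y f g k : ℕ} {b : Bool}

theorem fwdList_up (r : Carry) (l : List Cell) :
    (decider s₀ δ out pad).fwdList (.up r) l = (.up (arithList r l).1, (arithList r l).2) := by
  induction l generalizing r with
  | nil => rfl
  | cons a l ih =>
    rw [Sweeper.fwdList, arithList]
    simp only [decider] at ih ⊢
    rw [ih]

theorem fwdList_down (s : S) (r : Carry) (l : List Cell) :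
    (decider s₀ δ out pad).fwdList (.down s r) l =
      (.down s (arithList r l).1, (arithList r l).2) := by
  induction l generalizing r with
  | nil => rfl
  | cons a l ih =>
    rw [Sweeper.fwdList, arithList]
    simp only [decider] at ih ⊢
    rw [ih]

theorem Tape.xf_eq (h : Tape l n x y f g) : (arithList .zero l).1.xf = decide (x < f) := by
  obtain ⟨h1, h2, h3, h4, h5, h6, -⟩ := arithList_spec .zero l
  have hf := track_lt Cell.f l
  have hx := track_lt Cell.xf (arithList .zero l).2
  rw [h1] at hx
  rw [h.x, h.f] at h6
  rw [h.f] at hf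
  cases hc : (arithList .zero l).1.xf <;> simp [hc] at h6 hx ⊢ <;> omega

theorem Tape.nonzero_eq (h : Tape l n x y f g) :
    (arithList .zero l).1.nonzero = decide (f ≠ 0) := by
  rw [(arithList_spec .zero l).2.2.2.2.2.2.2.2.2, h.f]
  rfl

theorem Tape.arithList (h : Tape l n x y f g) (r : Carry) : Tape (arithList r l).2 n x y f g := by
  obtain ⟨h1, h2, h3, h4, h5, -⟩ := arithList_spec r l
  exact ⟨h1.trans h.length, h2.trans h.x, h3.trans h.y, h4.trans h.f, h5.trans h.g⟩

theorem halts_up_stop (h : Tape l n x y f g) (hx : x < f)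
    (hk : ∀ l', Tape l' n x y f g → (decider s₀ δ out pad).Halts k (.down s₀ .zero) l' b) :
    (decider s₀ δ out pad).Halts (k + 1) (.up .zero) l b := by
  refine .round rfl ?_
  rw [fwdList_up]
  simp only [decider, h.xf_eq, hx, decide_true, if_true, List.map_id']
  exact hk _ (h.arithList _)

theorem halts_up_continue (h : Tape l n x y f g) (hx : f ≤ x) (hfg : f + g < 2 ^ n)
    (hk : ∀ l', Tape l' n x y g (f + g) → (decider s₀ δ out pad).Halts k (.up .zero) l' b) :
    (decider s₀ δ out pad).Halts (k + 1) (.up .zero) l b := by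
  refine .round rfl ?_
  rw [fwdList_up]
  simp only [decider, h.xf_eq, not_lt.2 hx, decide_false, if_false, Bool.false_eq_true]
  refine hk _ ?_
  have h' := h.arithList .zero
  refine ⟨by rw [List.length_map, h'.length], ?_, ?_, ?_, ?_⟩ <;> rw [track_map]
  · exact h'.x
  · exact h'.y
  · exact h'.g
  · have h8 := (arithList_spec .zero l).2.2.2.2.2.2.2.1
    rw [h.f, h.g, h.length] at h8
    cases hc : (MaharajaNim.arithList .zero l).1.sum
    · simpa [hc] using h8
    · simp [hc] at h8
      omega

/-- The second coordinate may fall below zero, so it is tracked only modulo `2 ^ n`. -/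
theorem halts_down_step {s : S} (h : Tape l n x y f g) (hf : 0 < f) (hfg : f ≤ g)
    (hk : ∀ l' y', Tape l' n (if f ≤ x then x - f else x) y' (g - f) f →
      (y' : ℤ) ≡ y - (decide (f ≤ x)).toNat * g [ZMOD 2 ^ n] →
      (decider s₀ δ out pad).Halts k (.down (δ s (decide (f ≤ x))) .zero) l' b) :
    (decider s₀ δ out pad).Halts (k + 1) (.down s .zero) l b := by
  refine .round rfl ?_
  rw [fwdList_down]
  have hd : (!decide (x < f)) = decide (f ≤ x) := by
    by_cases hx : x < f
    · simp [hx]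
    · simp [hx, not_lt.1 hx]
  simp only [decider, h.xf_eq, h.nonzero_eq, hf.ne', ne_eq, not_false_eq_true, decide_true, if_true,
    hd]
  have h' := h.arithList .zero
  obtain ⟨-, -, -, -, -, h6, h7, -, h9, -⟩ := arithList_spec .zero l
  rw [h.f, h.g, h.length] at h9
  rw [h.x, h.f, h.xf_eq, h.length] at h6
  rw [h.y, h.g, h.length] at h7
  have hgf : track Cell.gf (MaharajaNim.arithList .zero l).2 = g - f := by
    have hlt := track_lt Cell.gf (MaharajaNim.arithList .zero l).2
    rw [h'.length] at hlt
    cases hc : (MaharajaNim.arithList .zero l).1.gf <;> simp [hc] at h9 <;> omega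
  by_cases hx : f ≤ x
  · refine hk _ (track Cell.yg (MaharajaNim.arithList .zero l).2)
      ⟨by rw [List.length_map, h'.length], ?_, ?_, ?_, ?_⟩ ?_
    · rw [track_map]
      simp only [not_lt.2 hx, hx, decide_false, if_true, Bool.false_eq_true, if_false,
        Bool.toNat_false, mul_zero] at h6 ⊢
      rw [show Carry.zero.xf.toNat = 0 from rfl] at h6
      exact Nat.eq_sub_of_add_eq h6
    · rw [track_map]
      simp only [not_lt.2 hx, decide_false, Bool.false_eq_true, if_false]
    · rw [track_map]
      exact hgf
    · rw [track_map]
      exact h'.f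
    · rw [decide_eq_true hx, Int.modEq_iff_dvd]
      refine ⟨-((MaharajaNim.arithList .zero l).1.yg.toNat : ℤ), ?_⟩
      have h7' := congrArg (Nat.cast : ℕ → ℤ) h7
      push_cast at h7'
      simp at h7' ⊢
      linarith
  · refine hk _ y ⟨by rw [List.length_map, h'.length], ?_, ?_, ?_, ?_⟩ ?_
    · rw [track_map]
      simp only [not_le.1 hx, hx, decide_true, if_true, if_false]
      exact h'.x
    · rw [track_map]
      simp only [not_le.1 hx, decide_true, if_true]
      exact h'.y
    · rw [track_map]
      exact hgf
    · rw [track_map]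
      exact h'.f
    · simp [hx]

/-- Once the parities agree, halving both sides with floor reduces a congruence modulo `2 ^ (k + 1)`
to one modulo `2 ^ k`. -/
theorem fwdList_check (ok : Bool) (c : Bounded C) (l : List Cell) :
    ∃ c' : Bounded C, (decider s₀ δ out pad).fwdList (.check ok c) l =
      (.check (ok && decide ((track Cell.y l : ℤ) ≡ c.1 [ZMOD 2 ^ l.length])) c', l) := by
  induction l generalizing ok c with
  | nil => exact ⟨c, by simp [Sweeper.fwdList, Int.modEq_one]⟩
  | cons a l ih =>
    obtain ⟨c', h⟩ := ih (ok && (a.y == decide (c.1 % 2 = 1))) c.half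
    refine ⟨c', ?_⟩
    rw [Sweeper.fwdList]
    simp only [decider] at h ⊢
    rw [h, Bool.and_assoc]
    have key : ((a.y == decide (c.1 % 2 = 1)) &&
        decide ((track Cell.y l : ℤ) ≡ c.half.1 [ZMOD 2 ^ l.length])) =
        decide ((track Cell.y (a :: l) : ℤ) ≡ c.1 [ZMOD 2 ^ (a :: l).length]) := by
      rw [Bool.eq_iff_iff]
      simp only [Bool.and_eq_true, beq_iff_eq, decide_eq_true_eq, Int.modEq_iff_dvd, track_cons,
        List.length_cons, pow_succ, Bounded.half]
      push_cast
      generalize (track Cell.y l : ℤ) = v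
      generalize c.1 = z
      generalize (2 ^ l.length : ℤ) = w
      constructor
      · rintro ⟨h1, q, h2⟩
        refine ⟨q, ?_⟩
        have : z = 2 * (z / 2) + a.y.toNat := by
          cases hy : a.y <;> simp [hy] at h1 ⊢ <;> omega
        rw [this]
        linear_combination 2 * h2
      · rintro ⟨q, h2⟩
        have h3 : z = 2 * (w * q + v) + a.y.toNat := by linear_combination h2
        generalize w * q + v = u at h3
        cases hy : a.y <;> simp [hy] at h3 h2 ⊢
        · refine ⟨by omega, q, ?_⟩
          have : z / 2 * 2 = z := by omega
          linarith
        · refine ⟨by omega, q, ?_⟩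
          have : z / 2 * 2 = z - 1 := by omega
          linarith
    rw [key]

/-- The verdict that the machine finds at the end of the digits. -/
def finalVerdict (out : S → Option (Bounded C)) (n : ℕ) (s : S) (y : ℤ) : Bool :=
  (out s).any fun c => decide (y ≡ c.1 [ZMOD 2 ^ n])

theorem finalVerdict_congr {s : S} {y y' : ℤ} (h : y ≡ y' [ZMOD 2 ^ n]) :
    finalVerdict out n s y = finalVerdict out n s y' := by
  unfold finalVerdict
  congr 1
  funext c
  exact decide_eq_decide.2 ⟨h.symm.trans, h.trans⟩

theorem halts_down_stop {s : S} (h : Tape l n x y 0 g) :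
    (decider s₀ δ out pad).Halts 2 (.down s .zero) l (finalVerdict out n s y) := by
  have h' := h.arithList .zero
  refine .round rfl ?_
  rw [fwdList_down]
  have e2 : (MaharajaNim.arithList .zero l).2.map
      ((decider s₀ δ out pad).commit (.down s (MaharajaNim.arithList .zero l).1)) =
      (MaharajaNim.arithList .zero l).2 := by
    simp [decider, h.nonzero_eq]
  simp only [e2]
  have e1 : ∃ (ok : Bool) (c : Bounded C),
      (decider s₀ δ out pad).turn (.down s (MaharajaNim.arithList .zero l).1) = .check ok c ∧
      finalVerdict out n s y = (ok && decide ((y : ℤ) ≡ c.1 [ZMOD 2 ^ n])) := by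
    cases hs : out s with
    | none => exact ⟨false, ⟨0, by simp⟩, by simp [decider, h.nonzero_eq, hs], by simp [finalVerdict, hs]⟩
    | some c => exact ⟨true, c, by simp [decider, h.nonzero_eq, hs], by simp [finalVerdict, hs]⟩
  obtain ⟨ok, c, e1, e3⟩ := e1
  rw [e1, e3]
  refine .round rfl ?_
  obtain ⟨c', hc'⟩ := fwdList_check (s₀ := s₀) (δ := δ) (out := out) (pad := pad) ok c
    (MaharajaNim.arithList .zero l).2
  rw [hc', h'.length, h'.y]
  exact .done _ rfl

/-! ### Greedy Fibonacci digits, and the run of the machine. -/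

theorem foldl_appendDigit (u : ℕ) (es : List Bool) :
    es.foldl appendDigit (u, 0) =
      (u * Nat.fib (es.length + 1) + (digitPair es).1,
        u * Nat.fib es.length + (digitPair es).2) := by
  induction es using List.reverseRecOn with
  | nil => simp [digitPair]
  | append_singleton es c ih =>
    rw [List.foldl_append, ih, digitPair_append, List.length_append]
    simp only [List.foldl_cons, List.foldl_nil, appendDigit, List.length_singleton]
    rw [Nat.fib_add_two (n := es.length)]
    ext <;> ring

theorem digitPair_cons (c : Bool) (es : List Bool) :
    digitPair (c :: es) =
      (c.toNat * Nat.fib (es.length + 1) + (digitPair es).1,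
        c.toNat * Nat.fib es.length + (digitPair es).2) := by
  rw [← foldl_appendDigit]
  simp [digitPair, appendDigit]

/-- The `j` digits of `x` in the Fibonacci numeration that the greedy algorithm finds. -/
def greedyDigits : ℕ → ℕ → List Bool
  | 0, _ => []
  | j + 1, x =>
    decide (Nat.fib (j + 1) ≤ x) ::
      greedyDigits j (if Nat.fib (j + 1) ≤ x then x - Nat.fib (j + 1) else x)

theorem length_greedyDigits (j x : ℕ) : (greedyDigits j x).length = j := by
  induction j generalizing x with
  | zero => rfl
  | succ j ih => rw [greedyDigits, List.length_cons, ih]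

theorem sub_fib_lt {j x : ℕ} (hx : x < Nat.fib (j + 2)) :
    (if Nat.fib (j + 1) ≤ x then x - Nat.fib (j + 1) else x) < Nat.fib (j + 1) := by
  have := Nat.fib_add_two (n := j)
  have := Nat.fib_le_fib_succ (n := j)
  split_ifs <;> omega

/-- Only the value matters, not a normal form of the digits: the automaton is correct on every digit
string. -/
theorem digitPair_greedyDigits (j : ℕ) {x : ℕ} (hx : x < Nat.fib (j + 1)) :
    (digitPair (greedyDigits j x)).1 = x := by
  induction j generalizing x with
  | zero =>
    simp at hx
    simp [greedyDigits, digitPair, hx]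
  | succ j ih =>
    rw [greedyDigits, digitPair_cons, length_greedyDigits]
    dsimp only
    rw [ih (sub_fib_lt hx)]
    split_ifs with h
    · simp [h]
    · simp [h]

/-- The phase in which the digits are found. -/
theorem halts_down (j : ℕ) {s : S} (h : Tape l n x y (Nat.fib j) (Nat.fib (j + 1)))
    (hx : x < Nat.fib (j + 1)) :
    (decider s₀ δ out pad).Halts (j + 2) (.down s .zero) l
      (finalVerdict out n ((greedyDigits j x).foldl δ s) ((y : ℤ) -
        ((digitPair (greedyDigits j x)).1 + (digitPair (greedyDigits j x)).2 : ℕ))) := by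
  induction j generalizing l x y s with
  | zero => simpa [greedyDigits, digitPair] using halts_down_stop h
  | succ j ih =>
    have hf := Nat.fib_add_two (n := j)
    rw [show j + 1 + 2 = j + 2 + 1 by ring]
    refine halts_down_step h (Nat.fib_pos.2 (by omega)) Nat.fib_le_fib_succ fun l' y' h' hy => ?_
    rw [show Nat.fib (j + 1 + 1) - Nat.fib (j + 1) = Nat.fib j from Nat.sub_eq_of_eq_add hf] at h'
    convert ih h' (sub_fib_lt hx) using 1
    rw [greedyDigits, List.foldl_cons]
    refine finalVerdict_congr ?_
    rw [digitPair_cons, length_greedyDigits]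
    refine Int.ModEq.trans ?_ (hy.symm.sub_right _)
    rw [show Nat.fib (j + 1 + 1) = _ from hf]
    push_cast
    exact congrArg (· % _) (by ring)

/-- The phase in which the Fibonacci numbers are computed. -/
theorem halts_up (i : ℕ) {j m : ℕ} (hm : j + i = m)
    (h : Tape l n x y (Nat.fib j) (Nat.fib (j + 1))) (hx : x < Nat.fib m)
    (hmin : ∀ j' < m, Nat.fib j' ≤ x) (hn : 3 * x + 1 < 2 ^ n) :
    (decider s₀ δ out pad).Halts (m + 2 + i + 1) (.up .zero) l
      (finalVerdict out n ((greedyDigits m x).foldl δ s₀) ((y : ℤ) -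
        ((digitPair (greedyDigits m x)).1 + (digitPair (greedyDigits m x)).2 : ℕ))) := by
  induction i generalizing j l with
  | zero =>
    obtain rfl : j = m := hm
    exact halts_up_stop h hx fun l' h' =>
      halts_down j h' (hx.trans_le Nat.fib_le_fib_succ)
  | succ i ih =>
    have hj := hmin j (by omega)
    -- With `fib j ≤ x` this bounds the next sum by `3 * x + 1`, so the tape does not overflow.
    have hf : Nat.fib (j + 1) ≤ 2 * Nat.fib j + 1 := by
      rcases j with _ | j
      · simp
      · have h1 : Nat.fib (j + 1 + 1) = _ := Nat.fib_add_two
        have h2 := Nat.fib_le_fib_succ (n := j)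
        omega
    refine halts_up_continue h hj (by omega) fun l' h' => ?_
    rw [← Nat.fib_add_two] at h'
    exact ih (by omega) h'

theorem bitsVal_map_false {α : Type} (l : List α) : bitsVal (l.map fun _ => false) = 0 := by
  induction l with
  | nil => rfl
  | cons a l ih => rw [List.map_cons, bitsVal, ih]; rfl

theorem fwdList_order (lt : Bool) (l : List Cell) :
    ∃ (lt' : Bool) (d : ℕ), (decider s₀ δ out pad).fwdList (.order false lt) l =
      (.order false lt', l.map fun a => { a with g := false }) ∧ d < 2 ^ l.length ∧
      d + track Cell.x l + lt.toNat = track Cell.y l + 2 ^ l.length * lt'.toNat := by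
  induction l generalizing lt with
  | nil => exact ⟨lt, 0, rfl, by simp, by simp [track, bitsVal]⟩
  | cons a l ih =>
    obtain ⟨lt', d, h1, h2, h3⟩ := ih (borrow a.y a.x lt)
    refine ⟨lt', (a.y ^^ a.x ^^ lt).toNat + 2 * d, ?_, ?_, ?_⟩
    · rw [Sweeper.fwdList]
      simp only [decider] at h1 ⊢
      rw [h1]
      rfl
    · have := Bool.toNat_le (a.y ^^ a.x ^^ lt)
      rw [List.length_cons, pow_succ]
      omega
    · have := borrow_spec a.y a.x lt
      rw [List.length_cons, two_pow_succ_mul, track_cons, track_cons]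
      omega

/-- The first round orders the coordinates. -/
theorem halts_order (hl : l.length = n) (hn : 0 < n) (hx : track Cell.x l = x)
    (hy : track Cell.y l = y) (hf : track Cell.f l = 0)
    (hk : ∀ l', Tape l' n (min x y) (max x y) 0 1 →
      (decider s₀ δ out pad).Halts k (.up .zero) l' b) :
    (decider s₀ δ out pad).Halts (k + 1) (.order true false) l b := by
  cases l with
  | nil => simp at hl; omega
  | cons a l =>
    refine .round rfl ?_
    obtain ⟨lt, d, h1, h2, h3⟩ := fwdList_order (s₀ := s₀) (δ := δ) (out := out) (pad := pad)
      (borrow a.y a.x false) l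
    have e : (decider s₀ δ out pad).fwdList (.order true false) (a :: l) = (.order false lt,
        { a with g := true } :: l.map fun a => { a with g := false }) := by
      rw [Sweeper.fwdList]
      simp only [decider] at h1 ⊢
      rw [h1]
    have h4 := borrow_spec a.y a.x false
    have h5 := Bool.toNat_le (a.y ^^ a.x ^^ false)
    rw [track_cons] at hx hy hf
    have hg : track (fun _ => false) l = 0 := bitsVal_map_false l
    have hf' : a.f = false ∧ track Cell.f l = 0 :=
      ⟨Bool.toNat_eq_zero.1 (by omega), by omega⟩
    rw [e]
    refine hk _ ?_
    cases lt
    · have hxy : x ≤ y := by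
        simp only [Bool.toNat_false, mul_zero] at h3 h4
        omega
      rw [min_eq_left hxy, max_eq_right hxy]
      refine ⟨by simpa using hl, ?_, ?_, ?_, ?_⟩ <;>
        simp [decider, track_cons, track_map, hg] <;>
        first | exact hf' | omega
    · have hxy : y ≤ x := by
        simp only [Bool.toNat_false, Bool.toNat_true, mul_one] at h3 h4
        omega
      rw [min_eq_right hxy, max_eq_left hxy]
      refine ⟨by simpa using hl, ?_, ?_, ?_, ?_⟩ <;>
        simp [decider, track_cons, track_map, hg] <;>
        first | exact hf' | omega

theorem two_pow_le_fib (i : ℕ) : 2 ^ i ≤ Nat.fib (2 * i + 1) := by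
  induction i with
  | zero => simp
  | succ i ih =>
    have h1 := Nat.fib_add_two (n := 2 * i + 1)
    have h2 := Nat.fib_le_fib_succ (n := 2 * i + 1)
    rw [pow_succ, show 2 * (i + 1) + 1 = 2 * i + 1 + 2 by ring]
    omega

theorem digitPair_snd_le (ds : List Bool) : (digitPair ds).2 ≤ (digitPair ds).1 := by
  induction ds using List.reverseRecOn with
  | nil => simp [digitPair]
  | append_singleton ds c ih =>
    rw [digitPair_append, appendDigit]
    dsimp only
    omega

theorem track_merge (xs ys : List Bool) :
    track Cell.x ((decider s₀ δ out pad).merge (xs.map (decider s₀ δ out pad).cell) ys) =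
        bitsVal xs ∧
      track Cell.y ((decider s₀ δ out pad).merge (xs.map (decider s₀ δ out pad).cell) ys) =
        bitsVal ys ∧
      track Cell.f ((decider s₀ δ out pad).merge (xs.map (decider s₀ δ out pad).cell) ys) = 0 := by
  have h0 (p : ℕ) : bitsVal (List.replicate p false) = 0 := by
    have := bitsVal_map_false (List.replicate p false)
    rwa [List.map_replicate] at this
  induction xs generalizing ys with
  | nil =>
    induction ys with
    | nil => simp [Sweeper.merge, track, bitsVal, decider, h0]
    | cons y ys ih =>
      simp only [List.map_nil] at ih
      simp only [List.map_nil, Sweeper.merge, track_cons, ih]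
      simp [decider, bitsVal]
  | cons x xs ih =>
    cases ys with
    | nil =>
      simp only [List.map_cons, Sweeper.merge, track_cons, ih]
      simp [decider, bitsVal]
    | cons y ys =>
      simp only [List.map_cons, Sweeper.merge, track_cons, ih]
      simp [decider, bitsVal]

/-- Two integers that differ by less than the modulus are equal if congruent. -/
theorem finalVerdict_eq {s : S} {z : ℤ} (hz : |z| + C < 2 ^ n) :
    finalVerdict out n s z = decide ((out s).map Subtype.val = some z) := by
  rw [finalVerdict]
  cases hs : out s with
  | none => simp
  | some c =>
    have hc := c.2
    rw [Set.mem_Icc] at hc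
    have hz1 := neg_abs_le z
    have hz2 := le_abs_self z
    simp only [Option.any_some, Option.map_some, Option.some.injEq]
    refine decide_eq_decide.2 ⟨fun h => ?_, fun h => by rw [h]⟩
    refine (Int.sub_eq_zero.1 (Int.eq_zero_of_abs_lt_dvd ((Int.modEq_iff_dvd).1 h) ?_))
    rw [abs_lt]
    constructor <;> linarith

theorem isP_swap (x y : ℕ) : IsP (x, y) ↔ IsP (y, x) := by
  rw [isP_iff_kernel, isP_iff_kernel]
  exact ⟨Kernel.swap, Kernel.swap⟩

theorem polyTimeDecidable_isP : PolyTimeDecidable IsP := by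
  classical
  obtain ⟨S, hS, s₀, δ, out', hout⟩ := exists_digit_automaton
  obtain ⟨C, hC⟩ : ∃ C : ℕ, ∀ s, ∀ c ∈ out' s, -(C : ℤ) ≤ c ∧ c ≤ C := by
    refine ⟨∑ s, ((out' s).getD 0).natAbs, fun s c hc => ?_⟩
    have h1 := Finset.single_le_sum (f := fun s => ((out' s).getD 0).natAbs)
      (fun _ _ => Nat.zero_le _) (Finset.mem_univ s)
    rw [Option.mem_def] at hc
    simp only [hc, Option.getD_some] at h1
    omega
  let out (s : S) : Option (Bounded C) := (out' s).pmap Subtype.mk fun c hc => Set.mem_Icc.2 (hC s c hc)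
  have hout' (s : S) : (out s).map Subtype.val = out' s := by
    simp [out, Option.map_pmap]
  have : Fintype (Phase S C) := Fintype.ofFinite _
  have : Fintype Cell := Fintype.ofFinite _
  refine (decider s₀ δ out (C + 3)).computableInPolyTime _ 12 fun x y => ?_
  obtain ⟨h1, h2, h3⟩ := track_merge (s₀ := s₀) (δ := δ) (out := out) (pad := C + 3)
    (Computability.encodeNat x) (Computability.encodeNat y)
  have h4 := (decider s₀ δ out (C + 3)).length_merge
    ((Computability.encodeNat x).map (decider s₀ δ out (C + 3)).cell) (Computability.encodeNat y)
  have hx := bitsVal_lt (Computability.encodeNat x)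
  have hy := bitsVal_lt (Computability.encodeNat y)
  rw [bitsVal_encodeNat] at h1 h2 hx hy
  have e0 : ((decider s₀ δ out (C + 3)).commit (decider s₀ δ out (C + 3)).start) = id := rfl
  rw [List.length_map] at h4
  rw [e0, List.map_id]
  set N := (Computability.encodeNat x).length + (Computability.encodeNat y).length
  set L := max (Computability.encodeNat x).length (Computability.encodeNat y).length
  have hLN : L ≤ N := by omega
  have hx' : x < 2 ^ L := hx.trans_le (Nat.pow_le_pow_right (by norm_num) (le_max_left _ _))
  have hy' : y < 2 ^ L := hy.trans_le (Nat.pow_le_pow_right (by norm_num) (le_max_right _ _))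
  -- The `C + 3` padding cells make room for the Fibonacci sums, and for a final difference of at
  -- most `2 * 2 ^ L` compared with a constant of size at most `C`.
  have hn : 3 * 2 ^ L + C < 2 ^ (L + (C + 3)) := by
    have h5 : C + 1 ≤ 2 ^ C := Nat.lt_two_pow_self
    have h6 : 1 ≤ 2 ^ L := Nat.one_le_two_pow
    have h7 : 2 ^ (L + (C + 3)) = 8 * (2 ^ L * 2 ^ C) := by ring
    rw [h7]
    nlinarith
  have hmin : min x y < 2 ^ L := (min_le_left _ _).trans_lt hx'
  have hmax : max x y < 2 ^ L := max_lt hx' hy'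
  have hn3 : 3 * min x y + 1 < 2 ^ (L + (C + 3)) := lt_of_le_of_lt (by omega) hn
  have hex : ∃ m, min x y < Nat.fib m := ⟨2 * L + 1, hmin.trans_le (two_pow_le_fib L)⟩
  obtain ⟨m, hm, hm', hmle⟩ : ∃ m, min x y < Nat.fib m ∧ (∀ j < m, Nat.fib j ≤ min x y) ∧
      m ≤ 2 * L + 1 :=
    ⟨Nat.find hex, Nat.find_spec hex, fun j hj => not_lt.1 (Nat.find_min hex hj),
      Nat.find_min' hex (hmin.trans_le (two_pow_le_fib L))⟩
  have hlen : 0 < L + (C + 3) := by omega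
  have hdig := digitPair_greedyDigits m (hm.trans_le Nat.fib_le_fib_succ)
  have hsnd := digitPair_snd_le (greedyDigits m (min x y))
  -- One round orders the coordinates, `m + 1` rounds climb the Fibonacci numbers, and `m + 2`
  -- descend and compare; `m ≤ 2 * L + 1` makes this linear.
  refine ⟨m + 2 + m + 1 + 1, by omega, ?_⟩
  convert halts_order (s₀ := s₀) (δ := δ) (out := out) (pad := C + 3) h4 hlen h1 h2 h3
    fun l' h' => halts_up m (j := 0) (Nat.zero_add m) h' hm hm' hn3 using 1
  · rfl
  rw [finalVerdict_eq, hout', decide_eq_decide, ← hout, hdig]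
  · rcases le_total x y with h | h
    · rw [min_eq_left h, max_eq_right h, and_iff_left h]
    · rw [min_eq_right h, max_eq_left h, and_iff_left h, isP_swap]
  · rw [hdig] at hsnd ⊢
    have : |((max x y : ℕ) : ℤ) - (min x y + (digitPair (greedyDigits m (min x y))).2 : ℕ)| ≤
        2 * 2 ^ L := by
      have hp : ((2 ^ L : ℕ) : ℤ) = 2 ^ L := by push_cast; rfl
      rw [abs_le, ← hp]
      omega
    have hn' : ((3 * 2 ^ L + C : ℕ) : ℤ) < ((2 ^ (L + (C + 3)) : ℕ) : ℤ) := by exact_mod_cast hn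
    push_cast at hn' this ⊢
    have : (0 : ℤ) < 2 ^ L := by positivity
    change _ < (2 : ℤ) ^ (L + (C + 3))
    linarith

end MaharajaNim

theorem mainTheorem5 :
    MaharajaNim.dictionary.Generates MaharajaNim.initialStage MaharajaNim.bitString ∧
    MaharajaNim.dictionary.Converges MaharajaNim.initialStage MaharajaNim.bitString ∧
    MaharajaNim.PolyTimeDecidable MaharajaNim.IsP :=
  ⟨MaharajaNim.output_eq_bitString ▸ MaharajaNim.generates_output,
    MaharajaNim.output_eq_bitString ▸ MaharajaNim.converges_output,
    MaharajaNim.polyTimeDecidable_isP⟩
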